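/- Let $2^\omega=\{0,1\}^{\omega}$ be the Cantor space with the product topology, and let $X\subseteq 2^\omega$ belong to the $\sigma$-algebra of subsets of $2^\omega$ generated by the analytic subsets of $2^\omega$ (a set is analytic if it is empty or a continuous image of the Baire space $\omega^\omega$). Equip $X$ with the subspace topology and the countable infinite power $X^\omega$ with the product topology. Then $X^\omega$ is h-homogeneous, that is, every nonempty clopen subset of $X^\omega$, with the subspace topology, is homeomorphic to $X^\omega$. -/

import Mathlib

/-- A topological space is h-homogeneous if every nonempty clopen subspace of it is homeomorphic
to the whole space. -/
def IsHHomogeneous (Y : Type*) [TopologicalSpace Y] : Prop :=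
  ∀ C : Set Y, IsClopen C → C.Nonempty → Nonempty (C ≃ₜ Y)

/-! By Nikodym's theorem analytic sets have the Baire property, hence so does X inside its closure.
This gives a dichotomy (`exists_dense_isGδ_or_exists_meagre`): either X contains the trace on its
closure of a countable intersection of open sets, each dense in X, or some nonempty relatively open
part of X is covered by countably many closed sets that are nowhere dense in X.

In both cases Z = X^ω carries closed nowhere dense sets A_k that control decreasing sequences of
nonempty closed sets. In the first case, if the closures of the k-th sets in the compact product
(2^ω)^ω stay in the open sets that define the A_k, the intersection is nonempty by compactness. In
the second case the A_k cover Z, so sets avoiding them one after another have empty intersection.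

Two nonempty clopen sets P and Q are then matched in stages, as in the Knaster–Reichbach theorem.
Every nonempty open subset of Z contains a closed nowhere dense copy of Z, so A_k ∩ P can be copied
into Q and A_k ∩ Q into P. The two enlarged closed sets are matched point by point, and their
complements are cut into clopen rings, matched so that they converge to corresponding points
(`exists_matched_of_isClosedEmbedding`). The clopen pairs, now disjoint from A_k, are cut into small
pieces (`exists_matched_small`) and handed to the next stage. A point of P either is paired with a
point at a finite stage, or lies in a shrinking sequence of clopen sets whose partners also shrink.
By the choice of the A_k, the two sequences have a common point together or not at all, so the limit
is a homeomorphism (`nonempty_homeomorph_of_matchings`). -/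

open Set Topology Filter

/-! ### Matchings of clopen sets and their refinement -/

/-- A node of a matching is a pair of singletons or a pair of nonempty clopen sets satisfying `G`. -/
def IsNode {Z : Type*} [TopologicalSpace Z] (G : Set Z → Prop) (p : Set Z × Set Z) : Prop :=
  (∃ x y, p = ({x}, {y})) ∨
    ((IsClopen p.1 ∧ p.1.Nonempty ∧ G p.1) ∧ (IsClopen p.2 ∧ p.2.Nonempty ∧ G p.2))

theorem IsNode.swap {Z : Type*} [TopologicalSpace Z] {G : Set Z → Prop} {p : Set Z × Set Z}
    (h : IsNode G p) : IsNode G p.swap := by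
  rcases h with ⟨x, y, rfl⟩ | ⟨h1, h2⟩
  · exact Or.inl ⟨y, x, rfl⟩
  · exact Or.inr ⟨h2, h1⟩

theorem IsNode.mono {Z : Type*} [TopologicalSpace Z] {G G' : Set Z → Prop} {p : Set Z × Set Z}
    (h : IsNode G p) (hG : ∀ S, G S → G' S) : IsNode G' p := by
  rcases h with h | ⟨⟨h1, h2, h3⟩, h4, h5, h6⟩
  · exact Or.inl h
  · exact Or.inr ⟨⟨h1, h2, hG _ h3⟩, h4, h5, hG _ h6⟩

/-- `α` and `β` send the points of `U` and `V` to the nodes containing them, where the nodes form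
partitions of `U` and of `V`, matched continuously from left to right. -/
structure HalfMatched {Z : Type*} [TopologicalSpace Z] (G : Set Z → Prop) (U V : Set Z)
    (α β : Z → Set Z × Set Z) : Prop where
  mem : ∀ x ∈ U, x ∈ (α x).1
  sub_left : ∀ x ∈ U, (α x).1 ⊆ U
  sub_right : ∀ x ∈ U, (α x).2 ⊆ V
  eq_left : ∀ x ∈ U, ∀ x' ∈ (α x).1, α x' = α x
  eq_right : ∀ x ∈ U, ∀ y ∈ (α x).2, β y = α x
  cont : ∀ x ∈ U, ∀ O, IsOpen O → (α x).2 ⊆ O → ∀ᶠ x' in 𝓝[U] x, (α x').2 ⊆ O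
  node : ∀ x ∈ U, IsNode G (α x)

/-- A pair of matched partitions of `U` and `V`, continuous in both directions. -/
structure Matched {Z : Type*} [TopologicalSpace Z] (G : Set Z → Prop) (U V : Set Z)
    (α β : Z → Set Z × Set Z) : Prop where
  left : HalfMatched G U V α β
  right : HalfMatched G V U (fun y => (β y).swap) (fun x => (α x).swap)

section
variable {Z : Type*} [TopologicalSpace Z] {G G' : Set Z → Prop} {U V : Set Z}
  {α β : Z → Set Z × Set Z}

theorem Matched.const (h : IsNode G (U, V)) : Matched G U V (fun _ => (U, V)) (fun _ => (U, V)) := by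
  have : ∀ {U V : Set Z}, IsNode G (U, V) →
      HalfMatched G U V (fun _ => (U, V)) (fun _ => (U, V)) := fun h =>
    { mem := fun x hx => hx
      sub_left := fun _ _ => subset_rfl
      sub_right := fun _ _ => subset_rfl
      eq_left := fun _ _ _ _ => rfl
      eq_right := fun _ _ _ _ => rfl
      cont := fun _ _ _ _ h => Eventually.of_forall fun _ => h
      node := fun _ _ => h }
  exact ⟨this h, this h.swap⟩

/-- Only continuity needs an argument. A singleton node cannot shrink further, so there the
continuity of the outer matching suffices. On a clopen node the outer matching is locally constant,
and the continuity of the inner one takes over. -/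
theorem HalfMatched.comp (h : HalfMatched G U V α β) {σ τ : Set Z × Set Z → Z → Set Z × Set Z}
    (hs : ∀ p, IsNode G p → HalfMatched G' p.1 p.2 (σ p) (τ p)) :
    HalfMatched G' U V (fun x => σ (α x) x) (fun y => τ (β y) y) where
  mem x hx := (hs _ (h.node x hx)).mem x (h.mem x hx)
  sub_left x hx := ((hs _ (h.node x hx)).sub_left x (h.mem x hx)).trans (h.sub_left x hx)
  sub_right x hx := ((hs _ (h.node x hx)).sub_right x (h.mem x hx)).trans (h.sub_right x hx)
  eq_left x hx x' hx' := by
    have H := hs _ (h.node x hx)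
    have h1 := h.eq_left x hx x' (H.sub_left x (h.mem x hx) hx')
    change σ (α x') x' = _
    rw [h1]
    exact H.eq_left x (h.mem x hx) x' hx'
  eq_right x hx y hy := by
    have H := hs _ (h.node x hx)
    have h1 := h.eq_right x hx y (H.sub_right x (h.mem x hx) hy)
    change τ (β y) y = _
    rw [h1]
    exact H.eq_right x (h.mem x hx) y hy
  cont x hx O hO hxO := by
    have H := hs _ (h.node x hx)
    rcases h.node x hx with ⟨a, b, hab⟩ | ⟨⟨hc, -⟩, -⟩
    · have hr := H.sub_right x (h.mem x hx)
      have hsub : (α x).2 ⊆ O := by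
        have hm := H.node x (h.mem x hx)
        have hne : (σ (α x) x).2.Nonempty := by
          rcases hm with ⟨c, d, hcd⟩ | ⟨-, -, h', -⟩
          · rw [hcd]; exact singleton_nonempty _
          · exact h'
        obtain ⟨z, hz⟩ := hne
        have hz' := hr hz
        rw [hab] at hz' ⊢
        rw [mem_singleton_iff] at hz'
        simpa [← hz'] using hxO hz
      filter_upwards [h.cont x hx O hO hsub, self_mem_nhdsWithin] with x' hx' hU
      exact ((hs _ (h.node x' hU)).sub_right x' (h.mem x' hU)).trans hx'
    · have h1 := H.cont x (h.mem x hx) O hO hxO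
      rw [hc.isOpen.nhdsWithin_eq (h.mem x hx)] at h1
      refine mem_nhdsWithin_of_mem_nhds ?_
      filter_upwards [h1, hc.isOpen.mem_nhds (h.mem x hx)] with x' h2 h3
      have : α x' = α x := h.eq_left x hx x' h3
      simp only [this]
      exact h2
  node x hx := (hs _ (h.node x hx)).node x (h.mem x hx)

theorem Matched.comp (h : Matched G U V α β) {σ τ : Set Z × Set Z → Z → Set Z × Set Z}
    (hs : ∀ p, IsNode G p → Matched G' p.1 p.2 (σ p) (τ p)) :
    Matched G' U V (fun x => σ (α x) x) (fun y => τ (β y) y) := by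
  refine ⟨h.left.comp fun p hp => (hs p hp).left, ?_⟩
  exact h.right.comp (σ := fun p y => (τ p.swap y).swap) (τ := fun p x => (σ p.swap x).swap)
    fun p hp => (hs p.swap hp.swap).right

/-- Having values at all pairs `p`, with junk off the nodes, lets the refinements be chosen as
functions of the node alone. Singleton pairs are refined by themselves. -/
theorem exists_matched_of_isNode
    (hs : ∀ P Q : Set Z, IsClopen P → P.Nonempty → G P → IsClopen Q → Q.Nonempty → G Q →
      ∃ α β, Matched G' P Q α β) (p : Set Z × Set Z) :
    ∃ s t : Z → Set Z × Set Z, IsNode G p → Matched G' p.1 p.2 s t := by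
  by_cases hn : IsNode G p
  · rcases id hn with hp | ⟨⟨h1, h2, h3⟩, h4, h5, h6⟩
    · exact ⟨fun _ => p, fun _ => p, fun _ => Matched.const (Or.inl hp)⟩
    · obtain ⟨s, t, hst⟩ := hs _ _ h1 h2 h3 h4 h5 h6
      exact ⟨s, t, fun _ => hst⟩
  · exact ⟨fun _ => p, fun _ => p, fun h => absurd h hn⟩

/-- Refining the clopen nodes of a matching. -/
theorem Matched.exists_comp (h : Matched G U V α β)
    (hs : ∀ P Q : Set Z, IsClopen P → P.Nonempty → G P → IsClopen Q → Q.Nonempty → G Q →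
      ∃ α β, Matched G' P Q α β) :
    ∃ α' β', Matched G' U V α' β' := by
  choose σ τ h1 using exists_matched_of_isNode hs
  exact ⟨_, _, h.comp h1⟩

end

/-! ### Limits of refining sequences of matchings -/

section
variable {Z : Type*} [TopologicalSpace Z] {G : ℕ → Set Z → Prop} {U V : Set Z}

/-- A refining sequence of matchings. -/
structure MatchedSeq (G : ℕ → Set Z → Prop) (U V : Set Z) (a b : ℕ → Z → Set Z × Set Z) : Prop where
  matched : ∀ k, HalfMatched (G k) U V (a k) (b k)
  anti_left : ∀ x ∈ U, Antitone fun k => (a k x).1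
  anti_right : ∀ x ∈ U, Antitone fun k => (a k x).2
  shrink : ∀ S : ℕ → Set Z, (∀ k, G k (S k)) → ∀ y, (∀ k, y ∈ S k) → ∀ O ∈ 𝓝 y, ∃ k, S k ⊆ O
  complete : ∀ S T : ℕ → Set Z, Antitone S → Antitone T → (∀ k, IsClosed (S k)) →
    (∀ k, IsClosed (T k)) → (∀ k, (S k).Nonempty) → (∀ k, (T k).Nonempty) → (∀ k, G k (S k)) →
    (∀ k, G k (T k)) → (⋂ k, S k).Nonempty → (⋂ k, T k).Nonempty

/-- Either some stage pairs `x` with a point, and the right-hand set is already a singleton, or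
every node of `x` is clopen and satisfies `G k`, so that `shrink` applies. -/
theorem MatchedSeq.shrink_right {a b : ℕ → Z → Set Z × Set Z} (h : MatchedSeq G U V a b)
    {x : Z} (hx : x ∈ U) {y : Z} (hy : ∀ k, y ∈ (a k x).2) {O : Set Z} (hO : O ∈ 𝓝 y) :
    ∃ k, (a k x).2 ⊆ O := by
  by_cases hs : ∃ k p q, a k x = ({p}, {q})
  · obtain ⟨k, p, q, hk⟩ := hs
    refine ⟨k, ?_⟩
    have := hy k
    rw [hk] at this ⊢
    rw [mem_singleton_iff] at this
    simpa [← this] using mem_of_mem_nhds hO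
  · refine h.shrink (fun k => (a k x).2) (fun k => ?_) y hy O hO
    rcases (h.matched k).node x hx with ⟨p, q, hpq⟩ | h'
    · exact absurd ⟨k, p, q, hpq⟩ hs
    · exact h'.2.2.2

theorem MatchedSeq.shrink_left {a b : ℕ → Z → Set Z × Set Z} (h : MatchedSeq G U V a b)
    {x : Z} (hx : x ∈ U) {O : Set Z} (hO : O ∈ 𝓝 x) :
    ∃ k, (a k x).1 ⊆ O := by
  by_cases hs : ∃ k p q, a k x = ({p}, {q})
  · obtain ⟨k, p, q, hk⟩ := hs
    refine ⟨k, ?_⟩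
    have := (h.matched k).mem x hx
    rw [hk] at this ⊢
    rw [mem_singleton_iff] at this
    simpa [← this] using mem_of_mem_nhds hO
  · refine h.shrink (fun k => (a k x).1) (fun k => ?_) x (fun k => (h.matched k).mem x hx) O hO
    rcases (h.matched k).node x hx with ⟨p, q, hpq⟩ | h'
    · exact absurd ⟨k, p, q, hpq⟩ hs
    · exact h'.1.2.2

theorem MatchedSeq.exists_image {a b : ℕ → Z → Set Z × Set Z} (h : MatchedSeq G U V a b)
    {x : Z} (hx : x ∈ U) : ∃ y, ∀ k, y ∈ (a k x).2 := by
  have hne : ∀ k, (a k x).2.Nonempty := fun k => by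
    rcases (h.matched k).node x hx with ⟨p, q, hpq⟩ | h'
    · rw [hpq]; exact singleton_nonempty _
    · exact h'.2.2.1
  by_cases hs : ∃ k p q, a k x = ({p}, {q})
  · obtain ⟨k, p, q, hk⟩ := hs
    refine ⟨q, fun m => ?_⟩
    have hk2 : (a k x).2 = {q} := by rw [hk]
    -- Before stage `k` the sets contain `{q}`; after it they are nonempty subsets of `{q}`.
    rcases le_total m k with hm | hm
    · exact h.anti_right x hx hm (by simp [hk2])
    · obtain ⟨z, hz⟩ := hne m
      have := h.anti_right x hx hm hz
      simp only [hk2, mem_singleton_iff] at this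
      exact this ▸ hz
  · have hc : ∀ k, _ := fun k => ((h.matched k).node x hx).resolve_left
      fun ⟨p, q, hpq⟩ => hs ⟨k, p, q, hpq⟩
    -- The point `x` itself witnesses that the left-hand sets have a common point.
    obtain ⟨y, hy⟩ := h.complete (fun k => (a k x).1) (fun k => (a k x).2) (h.anti_left x hx)
      (h.anti_right x hx) (fun k => (hc k).1.1.isClosed) (fun k => (hc k).2.1.isClosed)
      (fun k => (hc k).1.2.1) hne (fun k => (hc k).1.2.2) (fun k => (hc k).2.2.2)
      ⟨x, mem_iInter.2 fun k => (h.matched k).mem x hx⟩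
    exact ⟨y, mem_iInter.1 hy⟩

theorem MatchedSeq.exists_map {a b : ℕ → Z → Set Z × Set Z} (h : MatchedSeq G U V a b) :
    ∃ f : U → V, Continuous f ∧ ∀ x : U, ∀ k, b k (f x) = a k x := by
  choose f hf using fun x : U => h.exists_image x.2
  refine ⟨fun x => ⟨f x, (h.matched 0).sub_right x x.2 (hf x 0)⟩, ?_, fun x k =>
    (h.matched k).eq_right x x.2 _ (hf x k)⟩
  refine Continuous.subtype_mk (continuous_iff_continuousAt.2 fun x => ?_) _
  intro O hO
  obtain ⟨O', hO', hoo, hxO⟩ := mem_nhds_iff.1 hO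
  obtain ⟨k, hk⟩ := h.shrink_right x.2 (hf x) (hoo.mem_nhds hxO)
  have := (h.matched k).cont x x.2 O' hoo hk
  rw [nhdsWithin_eq_map_subtype_coe x.2] at this
  have this' : ∀ᶠ x' : U in 𝓝 x, (a k x').2 ⊆ O' := this
  rw [mem_map]
  filter_upwards [this'] with x' hx'
  exact hO' (hx' (hf x' k))

/-- The limit maps in the two directions preserve every node, and a point is determined by its nodes
because they shrink to it. Hence the maps are mutually inverse. -/
theorem nonempty_homeomorph_of_matchedSeq [T1Space Z] {a b : ℕ → Z → Set Z × Set Z}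
    (h : MatchedSeq G U V a b)
    (h' : MatchedSeq G V U (fun k y => (b k y).swap) (fun k x => (a k x).swap)) :
    Nonempty (U ≃ₜ V) := by
  obtain ⟨f, hf, hfab⟩ := h.exists_map
  obtain ⟨g, hg, hgab⟩ := h'.exists_map
  have hgab' : ∀ y : V, ∀ k, a k (g y) = b k y := fun y k => by
    have := congrArg Prod.swap (hgab y k)
    simpa using this
  have inj : ∀ {U V : Set Z} {a b : ℕ → Z → Set Z × Set Z} (_ : MatchedSeq G U V a b) (x x' : U),
      (∀ k, a k x' = a k x) → x' = x := by
    intro U V a b h x x' hx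
    by_contra hne
    obtain ⟨k, hk⟩ := h.shrink_left x.2 (O := {(x' : Z)}ᶜ)
      (isOpen_compl_singleton.mem_nhds fun h => hne (Subtype.ext h.symm))
    have := (h.matched k).mem x' x'.2
    rw [hx k] at this
    exact hk this rfl
  refine ⟨⟨⟨f, g, fun x => ?_, fun y => ?_⟩, hf, hg⟩⟩
  · exact inj h _ _ fun k => by rw [hgab', hfab]
  · exact inj h' _ _ fun k => by simp only [hfab, hgab']

theorem nonempty_homeomorph_of_matchings [T1Space Z]
    (hU : IsClopen U) (hUn : U.Nonempty) (hV : IsClopen V) (hVn : V.Nonempty)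
    (step : ∀ k, ∀ P Q : Set Z, IsClopen P → P.Nonempty → IsClopen Q → Q.Nonempty →
      ∃ α β, Matched (G k) P Q α β)
    (shrink : ∀ S : ℕ → Set Z, (∀ k, G k (S k)) → ∀ y, (∀ k, y ∈ S k) → ∀ O ∈ 𝓝 y, ∃ k, S k ⊆ O)
    (complete : ∀ S T : ℕ → Set Z, Antitone S → Antitone T → (∀ k, IsClosed (S k)) →
      (∀ k, IsClosed (T k)) → (∀ k, (S k).Nonempty) → (∀ k, (T k).Nonempty) → (∀ k, G k (S k)) →
      (∀ k, G k (T k)) → (⋂ k, S k).Nonempty → (⋂ k, T k).Nonempty) :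
    Nonempty (U ≃ₜ V) := by
  have key := fun k => exists_matched_of_isNode (G := fun _ => True) (G' := G k)
    fun P Q h1 h2 _ h3 h4 _ => step k P Q h1 h2 h3 h4
  choose σ τ hστ using key
  -- Stage `k + 1` refines each node of stage `k` separately. The condition `G k` is forgotten in
  -- between, since the next step only needs nonempty clopen sets.
  let ab : ℕ → (Z → Set Z × Set Z) × (Z → Set Z × Set Z) := fun k =>
    Nat.rec (σ 0 (U, V), τ 0 (U, V))
      (fun k ab => (fun x => σ (k + 1) (ab.1 x) x, fun y => τ (k + 1) (ab.2 y) y)) k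
  have hm : ∀ k, Matched (G k) U V (ab k).1 (ab k).2 := by
    intro k
    induction k with
    | zero => exact hστ 0 (U, V) (Or.inr ⟨⟨hU, hUn, trivial⟩, hV, hVn, trivial⟩)
    | succ k ih => exact ih.comp fun p hp => hστ (k + 1) p (hp.mono fun _ _ => trivial)
  have hn : ∀ k, ∀ x ∈ U, Matched (G (k + 1)) ((ab k).1 x).1 ((ab k).1 x).2
      (σ (k + 1) ((ab k).1 x)) (τ (k + 1) ((ab k).1 x)) := fun k x hx =>
    hστ (k + 1) _ (((hm k).left.node x hx).mono fun _ _ => trivial)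
  have hn' : ∀ k, ∀ y ∈ V, Matched (G (k + 1)) ((ab k).2 y).1 ((ab k).2 y).2
      (σ (k + 1) ((ab k).2 y)) (τ (k + 1) ((ab k).2 y)) := fun k y hy =>
    hστ (k + 1) _ (((hm k).right.node y hy).swap.mono fun _ _ => trivial)
  refine nonempty_homeomorph_of_matchedSeq (G := G) (a := fun k => (ab k).1) (b := fun k => (ab k).2)
    ⟨fun k => (hm k).left, fun x hx => antitone_nat_of_succ_le fun k => ?_,
      fun x hx => antitone_nat_of_succ_le fun k => ?_, shrink, complete⟩
    ⟨fun k => (hm k).right, fun x hx => antitone_nat_of_succ_le fun k => ?_,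
      fun x hx => antitone_nat_of_succ_le fun k => ?_, shrink, complete⟩
  · exact (hn k x hx).left.sub_left x ((hm k).left.mem x hx)
  · exact (hn k x hx).left.sub_right x ((hm k).left.mem x hx)
  · exact (hn' k x hx).right.sub_left x ((hm k).right.mem x hx)
  · exact (hn' k x hx).right.sub_right x ((hm k).right.mem x hx)

end

/-! ### Retractions and rings in ultrametric spaces -/

/-- A decreasing sequence of partitions of a space into open sets; `c m t` is the member of the
`m`-th partition that contains `t`. -/
structure OpenPartitionSeq {T : Type*} [TopologicalSpace T] (c : ℕ → T → Set T) : Prop where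
  mem : ∀ m t, t ∈ c m t
  eq : ∀ m t, ∀ t' ∈ c m t, c m t' = c m t
  anti : ∀ m t, c (m + 1) t ⊆ c m t
  isOpen : ∀ m t, IsOpen (c m t)

/-- A retraction `r` onto the range of `i` and a numbering `ρ` of rings around that range, such that
`r` maps each ring onto a set meeting all members of the corresponding partition. -/
structure RingRetraction {Z T : Type*} [MetricSpace Z] [TopologicalSpace T] (c : ℕ → T → Set T)
    (i : T → Z) (U : Set Z) (r : Z → T) (ρ : Z → ℕ) : Prop where
  retract : ∀ t, r (i t) = t
  locally_const : ∀ x ∉ range i, ∀ᶠ x' in 𝓝 x, x' ∉ range i ∧ r x' = r x ∧ ρ x' = ρ x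
  tendsto : ∀ t, ∀ m, ∀ N ∈ 𝓝 t, ∀ᶠ x in 𝓝 (i t), r x ∈ N ∧ (x ∉ range i → m ≤ ρ x)
  exists_mem : ∀ m t, ∃ x ∈ U \ range i, ρ x = m ∧ c m (r x) = c m t
  dist_le : ∀ x ∉ range i, ρ x * dist x (i (r x)) ≤ 2

section
variable {Z T : Type*} [MetricSpace Z] [IsUltrametricDist Z] [TopologicalSpace T]

theorem infDist_eq_of_mem_ball {D : Set Z} (hD : D.Nonempty) {x y : Z}
    (h : y ∈ Metric.ball x (Metric.infDist x D)) : Metric.infDist y D = Metric.infDist x D := by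
  have key : ∀ {x y : Z}, y ∈ Metric.ball x (Metric.infDist x D) →
      Metric.infDist x D ≤ Metric.infDist y D := by
    intro x y h
    refine (Metric.le_infDist hD).2 fun d hd => ?_
    have h1 := Metric.infDist_le_dist_of_mem (x := x) hd
    have h2 := IsUltrametricDist.dist_triangle_max x y d
    rw [Metric.mem_ball'] at h
    rcases le_max_iff.1 h2 with h3 | h3
    · linarith
    · linarith
  refine le_antisymm (key ?_) (key h)
  rw [Metric.mem_ball']
  exact (Metric.mem_ball.1 h).trans_le (key h)

/-- In an ultrametric space, every nonempty closed set is the range of a retraction that is locally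
constant off the set. -/
theorem exists_locally_const_retraction [Nonempty T] {i : T → Z} (hi : IsClosedEmbedding i) :
    ∃ r : Z → T, (∀ t, r (i t) = t) ∧
      (∀ x ∉ range i, dist x (i (r x)) < 2 * Metric.infDist x (range i)) ∧
      ∀ x ∉ range i, ∀ x' ∈ Metric.ball x (Metric.infDist x (range i)), r x' = r x := by
  classical
  set D := range i with hDdef
  have hDn : D.Nonempty := range_nonempty i
  have hpos : ∀ x ∉ D, 0 < Metric.infDist x D := fun x hx =>
    (hi.isClosed_range.notMem_iff_infDist_pos hDn).1 hx
  -- The value is chosen as a function of the ball as a set, so the retraction is constant on each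
  -- ball by construction.
  have pick : ∀ S : Set Z, ∃ t : T, ∀ x ∉ D, Metric.ball x (Metric.infDist x D) = S →
      dist x (i t) < 2 * Metric.infDist x D := by
    intro S
    by_cases hS : ∃ x ∉ D, Metric.ball x (Metric.infDist x D) = S
    · obtain ⟨x, hx, hxS⟩ := hS
      have hp := hpos x hx
      obtain ⟨_, ⟨t, rfl⟩, ht⟩ := (Metric.infDist_lt_iff hDn).1
        (show Metric.infDist x D < 2 * Metric.infDist x D by linarith)
      refine ⟨t, fun x' hx' hS' => ?_⟩
      have hm : x' ∈ Metric.ball x (Metric.infDist x D) := by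
        rw [hxS, ← hS']
        exact Metric.mem_ball_self (hpos x' hx')
      rw [infDist_eq_of_mem_ball hDn hm]
      refine (IsUltrametricDist.dist_triangle_max x' x (i t)).trans_lt (max_lt ?_ ht)
      have := Metric.mem_ball.1 hm
      linarith
    · exact ⟨Classical.arbitrary T, fun x hx hS' => absurd ⟨x, hx, hS'⟩ hS⟩
  choose pick hpick using pick
  refine ⟨fun x => if h : x ∈ D then h.choose else pick (Metric.ball x (Metric.infDist x D)),
    fun t => ?_, fun x hx => ?_, fun x hx x' hx' => ?_⟩
  · have h : i t ∈ D := mem_range_self t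
    simp only [h, dif_pos]
    exact hi.injective h.choose_spec
  · simp only [hx, dif_neg, not_false_eq_true]
    exact hpick _ x hx rfl
  · have h1 := infDist_eq_of_mem_ball hDn hx'
    have h2 : x' ∉ D := by
      rw [hi.isClosed_range.notMem_iff_infDist_pos hDn, h1]
      exact hpos x hx
    simp only [hx, h2, dif_neg, not_false_eq_true]
    rw [h1, ← IsUltrametricDist.ball_eq_of_mem hx']

/-- Rings are cut out by thresholds `E m t`, decreasing in `m` and constant on members of the `m`-th
partition: off the closed set, `ρ x` is the least `m` with `E (m + 1) (r x) ≤ δ x`. Each new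
threshold is at most the distance of a chosen point lying over the given member and below the old
threshold. That point falls in ring `m`, so the ring meets every fibre class. -/
theorem exists_ringRetraction [Nonempty T] {i : T → Z} (hi : IsClosedEmbedding i)
    (hd : interior (range i) = ∅) {U : Set Z} (hU : IsOpen U) (hiU : range i ⊆ U)
    {c : ℕ → T → Set T} (hc : OpenPartitionSeq c) :
    ∃ r ρ, RingRetraction c i U r ρ := by
  classical
  obtain ⟨r, hr, hrd, hrc⟩ := exists_locally_const_retraction hi
  set D := range i with hDdef
  have hDn : D.Nonempty := range_nonempty i
  have hpos : ∀ x ∉ D, 0 < Metric.infDist x D := fun x hx =>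
    (hi.isClosed_range.notMem_iff_infDist_pos hDn).1 hx
  set δ := fun x => Metric.infDist x D with hδ
  have hcont : ∀ t, ∀ N ∈ 𝓝 t, ∀ᶠ x in 𝓝 (i t), r x ∈ N := by
    intro t N hN
    rw [hi.isInducing.nhds_eq_comap, mem_comap] at hN
    obtain ⟨O, hO, hON⟩ := hN
    obtain ⟨ε, hε, hεO⟩ := Metric.mem_nhds_iff.1 hO
    filter_upwards [Metric.ball_mem_nhds (i t) (show 0 < ε / 2 by linarith)] with x hx
    apply hON
    apply hεO
    by_cases hxD : x ∈ D
    · obtain ⟨t', rfl⟩ := hxD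
      rw [hr]
      exact Metric.ball_subset_ball (by linarith) hx
    · rw [Metric.mem_ball] at hx ⊢
      have h1 := hrd x hxD
      have h2 : Metric.infDist x D ≤ dist x (i t) :=
        Metric.infDist_le_dist_of_mem (mem_range_self t)
      have h3 := IsUltrametricDist.dist_triangle_max (i (r x)) x (i t)
      rw [dist_comm (i (r x)) x] at h3
      exact h3.trans_lt (max_lt (by linarith) (by linarith))
  have hδc : ∀ t, ∀ ε > 0, ∀ᶠ x in 𝓝 (i t), δ x < ε := by
    intro t ε hε
    filter_upwards [Metric.ball_mem_nhds (i t) hε] with x hx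
    exact (Metric.infDist_le_dist_of_mem (mem_range_self t)).trans_lt hx
  -- Choosing `p` from the set and the threshold, not from `t`, is what keeps the next threshold
  -- constant on the member.
  have hex : ∀ (S : Set T) (ε : ℝ), ∃ p : Z, IsOpen S → S.Nonempty → 0 < ε →
      p ∈ U \ D ∧ r p ∈ S ∧ δ p < ε := by
    intro S ε
    by_cases h : IsOpen S ∧ S.Nonempty ∧ 0 < ε
    · obtain ⟨hS, ⟨t, ht⟩, hε⟩ := h
      have h1 := (hcont t S (hS.mem_nhds ht)).and ((hδc t ε hε).and
        (hU.mem_nhds (hiU (mem_range_self t))))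
      -- Nowhere density makes every point of the closed set a limit of points outside it.
      have h2 : ∃ᶠ x in 𝓝 (i t), x ∉ D := by
        intro h
        have : i t ∈ interior D := by
          rw [mem_interior_iff_mem_nhds]
          filter_upwards [h] with x hx
          simpa using hx
        rw [hd] at this
        exact this
      obtain ⟨p, hp1, hp2, hp3, hp4⟩ := (h2.and_eventually h1).exists
      exact ⟨p, fun _ _ _ => ⟨⟨hp4, hp1⟩, hp2, hp3⟩⟩
    · obtain ⟨x⟩ : Nonempty Z := ⟨i (Classical.arbitrary T)⟩
      exact ⟨x, fun h1 h2 h3 => absurd ⟨h1, h2, h3⟩ h⟩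
  choose p hp using hex
  -- The first term of the minimum puts `p` in ring `m`; the second makes ring `m + 1` lie within
  -- distance `1 / (m + 1)` of the closed set, which gives `dist_le`.
  let E : ℕ → T → ℝ := fun m => Nat.rec (fun _ => 1)
    (fun m e t => min (δ (p (c m t) (e t))) (1 / ((m : ℝ) + 1))) m
  have hE : ∀ m t, E (m + 1) t = min (δ (p (c m t) (E m t))) (1 / ((m : ℝ) + 1)) := fun m t => rfl
  have hEpos : ∀ m t, 0 < E m t := by
    intro m
    induction m with
    | zero => exact fun t => one_pos
    | succ m ih =>
      intro t
      rw [hE]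
      exact lt_min (hpos _ (hp _ _ (hc.isOpen m t) ⟨t, hc.mem m t⟩ (ih t)).1.2) (by positivity)
  have hP : ∀ m t, _ := fun m t => hp _ _ (hc.isOpen m t) ⟨t, hc.mem m t⟩ (hEpos m t)
  have hEanti : ∀ t, Antitone fun m => E m t := fun t =>
    antitone_nat_of_succ_le fun m => by
      rw [hE]
      exact (min_le_left _ _).trans (hP m t).2.2.le
  have hEconst' : ∀ m t, ∀ t' ∈ c m t, E m t' = E m t := by
    intro m
    induction m with
    | zero => exact fun _ _ _ => rfl
    | succ m ih =>
      intro t t' ht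
      have ht' := hc.anti m t ht
      rw [hE, hE, hc.eq m t t' ht', ih t t' ht']
  have hEconst : ∀ m t, ∀ t' ∈ c m t, E (m + 1) t' = E (m + 1) t := fun m t t' ht' => by
    rw [hE, hE, hc.eq m t t' ht', hEconst' m t t' ht']
  have hexists : ∀ x ∉ D, ∃ m, E (m + 1) (r x) ≤ δ x := by
    intro x hx
    obtain ⟨m, hm⟩ := exists_nat_one_div_lt (hpos x hx)
    exact ⟨m, (hE m (r x)).le.trans ((min_le_right _ _).trans hm.le)⟩
  let ρ : Z → ℕ := fun x => if h : ∃ m, E (m + 1) (r x) ≤ δ x then Nat.find h else 0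
  have hρ : ∀ x, ∀ h : x ∉ D, ρ x = Nat.find (hexists x h) := fun x h => dif_pos (hexists x h)
  have hle : ∀ x ∉ D, ∀ m, δ x < E m (r x) → m ≤ ρ x := by
    intro x hx m hm
    rw [hρ x hx, Nat.le_find_iff]
    exact fun j hj => not_le.2 (hm.trans_le (hEanti (r x) (Nat.succ_le_of_lt hj)))
  refine ⟨r, ρ, hr, fun x hx => ?_, fun t m N hN => ?_, fun m t => ?_, fun x hx => ?_⟩
  · filter_upwards [Metric.ball_mem_nhds x (hpos x hx)] with x' hx'
    have h1 : δ x' = δ x := infDist_eq_of_mem_ball hDn hx'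
    have h2 := hrc x hx x' hx'
    refine ⟨?_, h2, ?_⟩
    · rw [hi.isClosed_range.notMem_iff_infDist_pos hDn]
      exact (hpos x hx).trans_eq h1.symm
    · simp only [ρ, h1, h2]
  · filter_upwards [hcont t N hN, hcont t (c m t) ((hc.isOpen m t).mem_nhds (hc.mem m t)),
      hδc t (E m t) (hEpos m t)] with x h1 h2 h3
    refine ⟨h1, fun hx => hle x hx m ?_⟩
    rwa [hEconst' m t _ h2]
  · obtain ⟨h1, h2, h3⟩ := hP m t
    refine ⟨_, h1, le_antisymm ?_ (hle _ h1.2 m ?_), hc.eq m t _ h2⟩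
    · rw [hρ _ h1.2]
      refine Nat.find_min' _ ?_
      rw [hEconst m t _ h2, hE]
      exact min_le_left _ _
    · rwa [hEconst' m t _ h2]
  · rcases h : ρ x with _ | m
    · simp
    · have h1 : δ x < E (m + 1) (r x) := by
        by_contra hcon
        have := Nat.find_min' (hexists x hx) (not_lt.1 hcon)
        rw [← hρ x hx, h] at this
        omega
      have h2 : E (m + 1) (r x) ≤ 1 / ((m : ℝ) + 1) := min_le_right _ _
      have h3 := hrd x hx
      have h4 : dist x (i (r x)) ≤ 2 * (1 / ((m : ℝ) + 1)) := by
        have : Metric.infDist x D < 1 / ((m : ℝ) + 1) := h1.trans_le h2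
        linarith
      push_cast
      calc ((m : ℝ) + 1) * dist x (i (r x)) ≤ ((m : ℝ) + 1) * (2 * (1 / ((m : ℝ) + 1))) := by gcongr
        _ = 2 := by field_simp

end

/-! ### Matching the rings around two copies of a closed set -/

section
variable {Z T : Type*} [MetricSpace Z] [TopologicalSpace T]

/-- The part of the `m`-th ring over the member `S` of the `m`-th partition. -/
def ringPiece (c : ℕ → T → Set T) (i : T → Z) (U : Set Z) (r : Z → T) (ρ : Z → ℕ) (m : ℕ)
    (S : Set T) : Set Z :=
  {x | x ∈ U \ range i ∧ ρ x = m ∧ c m (r x) = S}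

open Classical in
/-- The node containing `x` in the matching that sends `i t` to `j t`. -/
noncomputable def ringNode (c : ℕ → T → Set T) (i : T → Z) (U : Set Z) (r : Z → T) (ρ : Z → ℕ)
    (j : T → Z) (V : Set Z) (s : Z → T) (σ : Z → ℕ) (x : Z) : Set Z × Set Z :=
  if x ∈ range i then ({x}, {j (r x)})
  else (ringPiece c i U r ρ (ρ x) (c (ρ x) (r x)), ringPiece c j V s σ (ρ x) (c (ρ x) (r x)))

variable {c : ℕ → T → Set T} {i : T → Z} {U : Set Z} {r : Z → T} {ρ : Z → ℕ}
  {j : T → Z} {V : Set Z} {s : Z → T} {σ : Z → ℕ}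

/-- A piece has no limit points on `range i`, where the ring numbers tend to infinity; elsewhere all
the data are locally constant. -/
theorem RingRetraction.isClopen_ringPiece (h : RingRetraction c i U r ρ) (hU : IsClopen U)
    (m : ℕ) (S : Set T) : IsClopen (ringPiece c i U r ρ m S) := by
  constructor
  · rw [← isOpen_compl_iff, isOpen_iff_mem_nhds]
    intro x hx
    by_cases hxi : x ∈ range i
    · obtain ⟨t, rfl⟩ := hxi
      filter_upwards [h.tendsto t (m + 1) univ univ_mem] with x' hx' hm
      have := hx'.2 hm.1.2
      have := hm.2.1
      omega
    · by_cases hxU : x ∈ U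
      · filter_upwards [h.locally_const x hxi] with x' hx' hm
        refine hx ⟨⟨hxU, hxi⟩, ?_, ?_⟩
        · rw [← hx'.2.2, hm.2.1]
        · rw [← hx'.2.1, hm.2.2]
      · filter_upwards [hU.compl.isOpen.mem_nhds hxU] with x' hx' hm
        exact hx' hm.1.1
  · rw [isOpen_iff_mem_nhds]
    rintro x ⟨⟨hxU, hxi⟩, h1, h2⟩
    filter_upwards [h.locally_const x hxi, hU.isOpen.mem_nhds hxU] with x' hx' hm
    exact ⟨⟨hm, hx'.1⟩, by rw [hx'.2.2, h1], by rw [hx'.2.1, h2]⟩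

/-- Pieces with equal ring number and equal partition member are paired. The delicate point is
continuity at `i t`: nearby points lie in rings of high number, and a partner piece in such a ring
is close to the `j`-image of a small partition member near `t`. -/
theorem RingRetraction.halfMatched (h : RingRetraction c i U r ρ) (h' : RingRetraction c j V s σ)
    (hc : OpenPartitionSeq c)
    (hU : IsClopen U) (hV : IsClopen V) (hj : IsClosedEmbedding j) (hjV : range j ⊆ V)
    (hcj : ∀ m t, ∀ t' ∈ c m t, ((m : ℝ) + 1) * dist (j t') (j t) ≤ 1) {A : Set Z}
    (hA : A ∩ U ⊆ range i) (hA' : A ∩ V ⊆ range j) :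
    HalfMatched (fun S => Disjoint S A) U V (ringNode c i U r ρ j V s σ)
      (fun y => (ringNode c j V s σ i U r ρ y).swap) := by
  have e1 : ∀ x ∈ range i, ringNode c i U r ρ j V s σ x = ({x}, {j (r x)}) := fun x hx => if_pos hx
  have e2 : ∀ x ∉ range i, ringNode c i U r ρ j V s σ x =
      (ringPiece c i U r ρ (ρ x) (c (ρ x) (r x)), ringPiece c j V s σ (ρ x) (c (ρ x) (r x))) :=
    fun x hx => if_neg hx
  have e1' : ∀ x ∈ range j, ringNode c j V s σ i U r ρ x = ({x}, {i (s x)}) := fun x hx => if_pos hx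
  have e2' : ∀ x ∉ range j, ringNode c j V s σ i U r ρ x =
      (ringPiece c j V s σ (σ x) (c (σ x) (s x)), ringPiece c i U r ρ (σ x) (c (σ x) (s x))) :=
    fun x hx => if_neg hx
  refine ⟨fun x hx => ?_, fun x hx => ?_, fun x hx => ?_, fun x hx x' hx' => ?_,
    fun x hx y hy => ?_, fun x hx O hO hxO => ?_, fun x hx => ?_⟩
  · by_cases hxi : x ∈ range i
    · rw [e1 x hxi]; exact mem_singleton x
    · rw [e2 x hxi]; exact ⟨⟨hx, hxi⟩, rfl, rfl⟩
  · by_cases hxi : x ∈ range i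
    · rw [e1 x hxi]; exact singleton_subset_iff.2 hx
    · rw [e2 x hxi]; exact fun z hz => hz.1.1
  · by_cases hxi : x ∈ range i
    · rw [e1 x hxi]; exact singleton_subset_iff.2 (hjV (mem_range_self _))
    · rw [e2 x hxi]; exact fun z hz => hz.1.1
  · by_cases hxi : x ∈ range i
    · rw [e1 x hxi] at hx'
      rw [mem_singleton_iff.1 hx']
    · rw [e2 x hxi] at hx'
      obtain ⟨⟨h1, h2⟩, h3, h4⟩ := hx'
      rw [e2 x hxi, e2 x' h2, h3, h4]
  · by_cases hxi : x ∈ range i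
    · rw [e1 x hxi] at hy ⊢
      rw [mem_singleton_iff.1 hy, e1' _ (mem_range_self _), h'.retract]
      obtain ⟨t, rfl⟩ := hxi
      rw [h.retract]
      rfl
    · rw [e2 x hxi] at hy ⊢
      obtain ⟨⟨h1, h2⟩, h3, h4⟩ := hy
      rw [e2' y h2, h3, h4]
      rfl
  · by_cases hxi : x ∈ range i
    · rw [e1 x hxi] at hxO
      obtain ⟨t, rfl⟩ := hxi
      rw [h.retract, singleton_subset_iff] at hxO
      obtain ⟨ε, hε, hεO⟩ := Metric.isOpen_iff.1 hO _ hxO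
      -- A partner `y` is within `2 / m` of `j (s y)`, which is within `1 / m` of `j (r x')`. The
      -- choice of `m` makes the total `3 / m` less than `ε / 2`, and the other half pays for the
      -- distance from `j (r x')` to `j t`.
      obtain ⟨m, hm⟩ := exists_nat_gt (6 / ε)
      have hm0 : (0 : ℝ) < m := (by positivity : (0 : ℝ) < 6 / ε).trans hm
      have hm1 : 6 < m * ε := by rwa [div_lt_iff₀ hε] at hm
      refine mem_nhdsWithin_of_mem_nhds ?_
      filter_upwards [h.tendsto t m (j ⁻¹' Metric.ball (j t) (ε / 2))
        (hj.continuous.continuousAt.preimage_mem_nhds (Metric.ball_mem_nhds _ (by linarith)))]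
        with x' hx'
      by_cases hxi' : x' ∈ range i
      · rw [e1 x' hxi', singleton_subset_iff]
        exact hεO (Metric.ball_subset_ball (by linarith) hx'.1)
      · rw [e2 x' hxi']
        rintro y ⟨⟨h1, h2⟩, h3, h4⟩
        apply hεO
        have hmρ : (m : ℝ) ≤ ρ x' := by exact_mod_cast hx'.2 hxi'
        have d1 := h'.dist_le y h2
        rw [h3] at d1
        have hmem : s y ∈ c (ρ x') (r x') := h4 ▸ hc.mem _ _
        have d2 := hcj _ _ _ hmem
        have d3 : dist (j (r x')) (j t) < ε / 2 := hx'.1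
        have t1 := dist_triangle y (j (s y)) (j t)
        have t2 := dist_triangle (j (s y)) (j (r x')) (j t)
        rw [Metric.mem_ball]
        have d1' : (m : ℝ) * dist y (j (s y)) ≤ 2 :=
          (mul_le_mul_of_nonneg_right hmρ dist_nonneg).trans d1
        have d2' : (m : ℝ) * dist (j (s y)) (j (r x')) ≤ 1 :=
          (mul_le_mul_of_nonneg_right (by linarith) dist_nonneg).trans d2
        have : (m : ℝ) * (dist y (j (s y)) + dist (j (s y)) (j (r x'))) < m * (ε / 2) := by
          nlinarith
        have := lt_of_mul_lt_mul_left this hm0.le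
        linarith
    · have := h.locally_const x hxi
      refine mem_nhdsWithin_of_mem_nhds ?_
      filter_upwards [this] with x' hx'
      rw [e2 x hxi] at hxO
      rw [e2 x' hx'.1, hx'.2.1, hx'.2.2]
      exact hxO
  · by_cases hxi : x ∈ range i
    · rw [e1 x hxi]; exact Or.inl ⟨_, _, rfl⟩
    · rw [e2 x hxi]
      refine Or.inr ⟨⟨h.isClopen_ringPiece hU _ _, ⟨x, ⟨hx, hxi⟩, rfl, rfl⟩, ?_⟩,
        h'.isClopen_ringPiece hV _ _, ?_, ?_⟩
      · exact disjoint_left.2 fun z hz hzA => hz.1.2 (hA ⟨hzA, hz.1.1⟩)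
      · obtain ⟨y, hy, h1, h2⟩ := h'.exists_mem (ρ x) (r x)
        exact ⟨y, hy, h1, h2⟩
      · exact disjoint_left.2 fun z hz hzA => hz.1.2 (hA' ⟨hzA, hz.1.1⟩)

theorem exists_matched_of_isClosedEmbedding [IsUltrametricDist Z]
    (hU : IsClopen U) (hUn : U.Nonempty) (hV : IsClopen V) (hVn : V.Nonempty)
    (hi : IsClosedEmbedding i) (hj : IsClosedEmbedding j)
    (hiU : range i ⊆ U) (hjV : range j ⊆ V)
    (hid : interior (range i) = ∅) (hjd : interior (range j) = ∅) {A : Set Z}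
    (hA : A ∩ U ⊆ range i) (hA' : A ∩ V ⊆ range j) :
    ∃ α β, Matched (fun S => Disjoint S A) U V α β := by
  rcases isEmpty_or_nonempty T with hT | hT
  · rw [range_eq_empty, subset_empty_iff] at hA hA'
    exact ⟨_, _, Matched.const (Or.inr ⟨⟨hU, hUn, (disjoint_iff_inter_eq_empty.2 hA).symm⟩, hV, hVn,
      (disjoint_iff_inter_eq_empty.2 hA').symm⟩)⟩
  -- The partition is fine for both embeddings at once, so the same rings serve in both directions.
  · let c : ℕ → T → Set T := fun m t => {t' | dist (i t') (i t) < 1 / ((m : ℝ) + 1) ∧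
      dist (j t') (j t) < 1 / ((m : ℝ) + 1)}
    have hc : OpenPartitionSeq c := by
      have hp : ∀ m : ℕ, (0 : ℝ) < 1 / ((m : ℝ) + 1) := fun m => by positivity
      refine ⟨fun m t => ?_, fun m t t' ht => ?_, fun m t t' ht => ?_, fun m t => ?_⟩
      · simp only [c, mem_ofPred_eq, dist_self]
        exact ⟨hp m, hp m⟩
      · have h1 := IsUltrametricDist.ball_eq_of_mem (Metric.mem_ball.2 ht.1)
        have h2 := IsUltrametricDist.ball_eq_of_mem (Metric.mem_ball.2 ht.2)
        ext z
        have g1 := Set.ext_iff.1 h1 (i z)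
        have g2 := Set.ext_iff.1 h2 (j z)
        exact (and_congr g1 g2).symm
      · have : 1 / (((m + 1 : ℕ) : ℝ) + 1) ≤ 1 / ((m : ℝ) + 1) := by
          push_cast
          apply one_div_le_one_div_of_le (by positivity)
          linarith
        exact ⟨ht.1.trans_le this, ht.2.trans_le this⟩
      · exact (Metric.isOpen_ball.preimage hi.continuous).inter
          (Metric.isOpen_ball.preimage hj.continuous)
    have hbound : ∀ (m : ℕ) (d : ℝ), d < 1 / ((m : ℝ) + 1) → ((m : ℝ) + 1) * d ≤ 1 := by
      intro m d hd
      rw [lt_div_iff₀ (by positivity)] at hd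
      linarith
    obtain ⟨r, ρ, h⟩ := exists_ringRetraction hi hid hU.isOpen hiU hc
    obtain ⟨s, σ, h'⟩ := exists_ringRetraction hj hjd hV.isOpen hjV hc
    exact ⟨_, _, h.halfMatched h' hc hU hV hj hjV (fun m t t' ht => hbound _ _ ht.2) hA hA',
      h'.halfMatched h hc hV hU hi hiU (fun m t t' ht => hbound _ _ ht.1) hA' hA⟩

end

/-! ### Clopen partitions and the Knaster–Reichbach theorem -/

section
variable {Z : Type*} [MetricSpace Z] {G : Set Z → Prop} {P Q : Set Z}

/-- `a` partitions `P` into nonempty clopen sets satisfying `G`. -/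
def IsClopenPartition {ι : Type*} (G : Set Z → Prop) (P : Set Z) (a : Z → ι) : Prop :=
  ∀ n, IsClopen (P ∩ a ⁻¹' {n}) ∧ (P ∩ a ⁻¹' {n}).Nonempty ∧ G (P ∩ a ⁻¹' {n})

theorem IsClopenPartition.halfMatched {ι : Type*} {a b : Z → ι} (ha : IsClopenPartition G P a)
    (hb : IsClopenPartition G Q b) :
    HalfMatched G P Q (fun x => (P ∩ a ⁻¹' {a x}, Q ∩ b ⁻¹' {a x}))
      (fun y => (P ∩ a ⁻¹' {b y}, Q ∩ b ⁻¹' {b y})) where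
  mem x hx := ⟨hx, rfl⟩
  sub_left x hx := inter_subset_left
  sub_right x hx := inter_subset_left
  eq_left x hx x' hx' := by
    have : a x' = a x := hx'.2
    simp only [this]
  eq_right x hx y hy := by
    have : b y = a x := hy.2
    simp only [this]
  cont x hx O hO hxO := by
    refine mem_nhdsWithin_of_mem_nhds ?_
    filter_upwards [(ha (a x)).1.isOpen.mem_nhds ⟨hx, rfl⟩] with x' hx'
    have : a x' = a x := hx'.2
    simp only [this]
    exact hxO
  node x hx := Or.inr ⟨ha (a x), hb (a x)⟩

theorem IsClopenPartition.matched {ι : Type*} {a b : Z → ι} (ha : IsClopenPartition G P a)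
    (hb : IsClopenPartition G Q b) : ∃ α β, Matched G P Q α β :=
  ⟨_, _, ha.halfMatched hb, hb.halfMatched ha⟩

theorem IsClopenPartition.equiv {ι κ : Type*} {a : Z → ι} (ha : IsClopenPartition G P a)
    (e : ι ≃ κ) : IsClopenPartition G P (e ∘ a) := by
  intro n
  have : P ∩ (e ∘ a) ⁻¹' {n} = P ∩ a ⁻¹' {e.symm n} := by
    ext x
    simp [Equiv.eq_symm_apply]
  rw [this]
  exact ha _

theorem IsClopenPartition.of_equiv {ι : Type*} (hP : P.Nonempty) {B : Z → Set Z}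
    (hmem : ∀ x ∈ P, x ∈ B x) (hsub : ∀ x ∈ P, B x ⊆ P) (hclopen : ∀ x ∈ P, IsClopen (B x))
    (hG : ∀ x ∈ P, G (B x)) (heq : ∀ x ∈ P, ∀ x' ∈ B x, B x' = B x) (e : B '' P ≃ ι) :
    ∃ a : Z → ι, IsClopenPartition G P a := by
  classical
  obtain ⟨x₀, hx₀⟩ := hP
  refine ⟨fun x => if h : x ∈ P then e ⟨B x, mem_image_of_mem B h⟩ else
    e ⟨B x₀, mem_image_of_mem B hx₀⟩, fun n => ?_⟩
  obtain ⟨⟨_, x, hx, rfl⟩, rfl⟩ := e.surjective n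
  have : (P ∩ (fun x => if h : x ∈ P then e ⟨B x, mem_image_of_mem B h⟩ else
    e ⟨B x₀, mem_image_of_mem B hx₀⟩) ⁻¹' {e ⟨B x, mem_image_of_mem B hx⟩}) = B x := by
    ext z
    simp only [mem_inter_iff, mem_preimage, mem_singleton_iff]
    constructor
    · rintro ⟨hz, h⟩
      rw [dif_pos hz, e.apply_eq_iff_eq, Subtype.mk.injEq] at h
      exact h ▸ hmem z hz
    · intro hz
      have hzP := hsub x hx hz
      refine ⟨hzP, ?_⟩
      rw [dif_pos hzP, e.apply_eq_iff_eq, Subtype.mk.injEq]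
      exact heq x hx z hz
  rw [this]
  exact ⟨hclopen x hx, ⟨x, hmem x hx⟩, hG x hx⟩

variable [IsUltrametricDist Z]

/-- Each point receives the largest admissible ball of radius `1 / (n + 1)`. In an ultrametric space
every point of a ball is a centre, so points of one such ball receive the same ball. -/
theorem exists_ball_partition (hP : IsOpen P) (hG : ∀ S T, G T → S ⊆ T → G S)
    (hloc : ∀ x ∈ P, ∃ O ∈ 𝓝 x, G O) :
    ∃ B : Z → Set Z, (∀ x ∈ P, x ∈ B x) ∧ (∀ x ∈ P, B x ⊆ P) ∧ (∀ x ∈ P, IsClopen (B x)) ∧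
      (∀ x ∈ P, G (B x)) ∧ ∀ x ∈ P, ∀ x' ∈ B x, B x' = B x := by
  classical
  have hex : ∀ x ∈ P, ∃ n : ℕ, Metric.ball x (1 / ((n : ℝ) + 1)) ⊆ P ∧
      G (Metric.ball x (1 / ((n : ℝ) + 1))) := by
    intro x hx
    obtain ⟨O, hO, hGO⟩ := hloc x hx
    obtain ⟨ε, hε, h⟩ := Metric.mem_nhds_iff.1 (inter_mem hO (hP.mem_nhds hx))
    obtain ⟨n, hn⟩ := exists_nat_one_div_lt hε
    have := (Metric.ball_subset_ball hn.le).trans h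
    exact ⟨n, this.trans inter_subset_right, hG _ _ hGO (this.trans inter_subset_left)⟩
  let N : Z → ℕ := fun x => if h : _ then Nat.find (p := fun n : ℕ =>
    Metric.ball x (1 / ((n : ℝ) + 1)) ⊆ P ∧ G (Metric.ball x (1 / ((n : ℝ) + 1)))) h else 0
  have hN : ∀ x, ∀ hx : x ∈ P, N x = Nat.find (hex x hx) := fun x hx => dif_pos (hex x hx)
  have hsp : ∀ x ∈ P, Metric.ball x (1 / ((N x : ℝ) + 1)) ⊆ P ∧
      G (Metric.ball x (1 / ((N x : ℝ) + 1))) := fun x hx => by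
    rw [hN x hx]
    exact Nat.find_spec (hex x hx)
  have hpos : ∀ n : ℕ, (0 : ℝ) < 1 / ((n : ℝ) + 1) := fun n => by positivity
  have hle : ∀ x ∈ P, ∀ x' ∈ Metric.ball x (1 / ((N x : ℝ) + 1)), N x' ≤ N x := by
    intro x hx x' hx'
    rw [hN x' ((hsp x hx).1 hx')]
    refine Nat.find_min' _ ?_
    rw [← IsUltrametricDist.ball_eq_of_mem hx']
    exact hsp x hx
  refine ⟨fun x => Metric.ball x (1 / ((N x : ℝ) + 1)), fun x _ => Metric.mem_ball_self (hpos _),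
    fun x hx => (hsp x hx).1, fun x _ => IsUltrametricDist.isClopen_ball _ _,
    fun x hx => (hsp x hx).2, fun x hx x' hx' => ?_⟩
  have h1 := hle x hx x' hx'
  have hx'P := (hsp x hx).1 hx'
  have h2 : N x ≤ N x' := by
    refine hle x' hx'P x ?_
    rw [Metric.mem_ball']
    refine (Metric.mem_ball.1 hx').trans_le ?_
    apply one_div_le_one_div_of_le (by positivity)
    have : (N x' : ℝ) ≤ N x := by exact_mod_cast h1
    linarith
  simp only [le_antisymm h1 h2]
  exact (IsUltrametricDist.ball_eq_of_mem hx').symm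

/-- If all such partitions were finite, a partition subordinate to an arbitrary open cover would
yield a finite subcover. An infinite one is countable, being a disjoint family of nonempty open sets
in a second countable space. -/
theorem exists_infinite_clopenPartition [SecondCountableTopology Z] (hP : IsOpen P)
    (hPc : ¬ IsCompact P) (hG : ∀ S T, G T → S ⊆ T → G S) (hloc : ∀ x ∈ P, ∃ O ∈ 𝓝 x, G O) :
    ∃ a : Z → ℕ, IsClopenPartition G P a := by
  have hne : P.Nonempty := by
    rw [nonempty_iff_ne_empty]
    rintro rfl
    exact hPc isCompact_empty
  obtain ⟨B, h1, h2, h3, h4, h5, hinf⟩ : ∃ B : Z → Set Z, (∀ x ∈ P, x ∈ B x) ∧ (∀ x ∈ P, B x ⊆ P) ∧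
      (∀ x ∈ P, IsClopen (B x)) ∧ (∀ x ∈ P, G (B x)) ∧ (∀ x ∈ P, ∀ x' ∈ B x, B x' = B x) ∧
      (B '' P).Infinite := by
    by_contra hcon
    push Not at hcon
    apply hPc
    refine isCompact_of_finite_subcover fun {κ} O hO hPO => ?_
    obtain ⟨B, h1, h2, h3, h4, h5⟩ := exists_ball_partition (G := fun S => G S ∧ ∃ k, S ⊆ O k) hP
      (fun S T hT hST => ⟨hG S T hT.1 hST, hT.2.imp fun k hk => hST.trans hk⟩) (fun x hx => by
        obtain ⟨W, hW, hGW⟩ := hloc x hx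
        obtain ⟨k, hk⟩ := mem_iUnion.1 (hPO hx)
        exact ⟨W ∩ O k, inter_mem hW ((hO k).mem_nhds hk), hG _ _ hGW inter_subset_left, k,
          inter_subset_right⟩)
    have hfin := hcon B h1 h2 h3 (fun x hx => (h4 x hx).1) h5
    have : Nonempty κ := (mem_iUnion.1 (hPO hne.some_mem)).nonempty
    choose! k hk using fun x hx => (h4 x hx).2
    obtain ⟨t, htP, ht⟩ := exists_subset_bijOn P B
    have htf := ht.finite_iff_finite.2 hfin
    refine ⟨(htf.image k).toFinset, fun x hx => ?_⟩
    obtain ⟨y, hy, hyx⟩ := ht.surjOn (mem_image_of_mem B hx)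
    simp only [Finite.mem_toFinset, mem_iUnion]
    exact ⟨k y, mem_image_of_mem k hy, hk y (htP hy) (hyx ▸ h1 x hx)⟩
  have hcount : (B '' P).Countable := by
    refine PairwiseDisjoint.countable_of_isOpen (s := id) ?_ ?_ ?_
    · rintro _ ⟨x, hx, rfl⟩ _ ⟨y, hy, rfl⟩ hxy
      refine disjoint_left.2 fun z hzx hzy => hxy ?_
      rw [← h5 x hx z hzx, h5 y hy z hzy]
    · rintro _ ⟨x, hx, rfl⟩
      exact (h3 x hx).isOpen
    · rintro _ ⟨x, hx, rfl⟩
      exact ⟨x, h1 x hx⟩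
  have := hcount.to_subtype
  have := hinf.to_subtype
  obtain ⟨_⟩ := nonempty_denumerable (B '' P)
  exact IsClopenPartition.of_equiv hne h1 h2 h3 h4 h5 (Denumerable.eqv (B '' P))

theorem exists_finite_clopenPartition (hP : IsOpen P) (hPn : P.Nonempty)
    (hPc : IsCompact P) (hG : ∀ S T, G T → S ⊆ T → G S) (hloc : ∀ x ∈ P, ∃ O ∈ 𝓝 x, G O) :
    ∃ n, ∃ a : Z → Fin n, IsClopenPartition G P a := by
  obtain ⟨B, h1, h2, h3, h4, h5⟩ := exists_ball_partition hP hG hloc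
  have hfin : (B '' P).Finite := by
    obtain ⟨t, htP, ht⟩ := hPc.elim_nhds_subcover B fun x hx => (h3 x hx).isOpen.mem_nhds (h1 x hx)
    refine (t.finite_toSet.image B).subset ?_
    rintro _ ⟨x, hx, rfl⟩
    obtain ⟨y, hy, hxy⟩ := mem_iUnion₂.1 (ht hx)
    exact ⟨y, hy, (h5 y (htP y hy) x hxy).symm⟩
  have := hfin.to_subtype
  exact ⟨_, IsClopenPartition.of_equiv hPn h1 h2 h3 h4 h5 (Finite.equivFin (B '' P))⟩

/-- Without isolated points, some member contains two points, and a ball around one that misses the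
other splits it. -/
theorem IsClopenPartition.exists_succ (hZ : ∀ x : Z, ¬ IsOpen {x})
    (hG : ∀ S T, G T → S ⊆ T → G S) (hPn : P.Nonempty) {n : ℕ} {a : Z → Fin n}
    (ha : IsClopenPartition G P a) : ∃ a' : Z → Fin (n + 1), IsClopenPartition G P a' := by
  classical
  obtain ⟨x, hx⟩ := hPn
  obtain ⟨h1, h2, h3⟩ := ha (a x)
  obtain ⟨y, hy, hyx⟩ : ∃ y ∈ P ∩ a ⁻¹' {a x}, y ≠ x := by
    by_contra hcon
    push Not at hcon
    apply hZ x
    have : P ∩ a ⁻¹' {a x} = {x} := Subset.antisymm hcon (singleton_subset_iff.2 ⟨hx, rfl⟩)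
    exact this ▸ h1.isOpen
  have hball : IsClopen (Metric.ball y (dist y x)) := IsUltrametricDist.isClopen_ball _ _
  have key : IsClopenPartition G P
      (fun z => if a z = a x ∧ z ∈ Metric.ball y (dist y x) then none else some (a z)) := by
    rintro (_ | m)
    · have : P ∩ (fun z => if a z = a x ∧ z ∈ Metric.ball y (dist y x) then none
          else some (a z)) ⁻¹' {none} = (P ∩ a ⁻¹' {a x}) ∩ Metric.ball y (dist y x) := by
        ext z
        simp only [mem_inter_iff, mem_preimage, mem_singleton_iff]
        split_ifs with h <;> tauto
      rw [this]
      exact ⟨h1.inter hball, ⟨y, hy, Metric.mem_ball_self (dist_pos.2 hyx)⟩,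
        hG _ _ h3 inter_subset_left⟩
    · by_cases hm : m = a x
      · subst hm
        have : P ∩ (fun z => if a z = a x ∧ z ∈ Metric.ball y (dist y x) then none
          else some (a z)) ⁻¹' {some (a x)} = (P ∩ a ⁻¹' {a x}) ∩ (Metric.ball y (dist y x))ᶜ := by
          ext z
          simp only [mem_inter_iff, mem_preimage, mem_singleton_iff, mem_compl_iff]
          split_ifs with h
          · simp only [and_false, false_iff]
            tauto
          · rw [Option.some_inj]
            tauto
        rw [this]
        refine ⟨h1.inter hball.compl, ⟨x, ⟨hx, rfl⟩, ?_⟩, hG _ _ h3 inter_subset_left⟩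
        simp [dist_comm]
      · have : P ∩ (fun z => if a z = a x ∧ z ∈ Metric.ball y (dist y x) then none
          else some (a z)) ⁻¹' {some m} = P ∩ a ⁻¹' {m} := by
          ext z
          simp only [mem_inter_iff, mem_preimage, mem_singleton_iff]
          split_ifs with h
          · simp only [and_false, false_iff, not_and]
            exact fun _ h' => hm (h'.symm.trans h.1)
          · simp
        rw [this]
        exact ha m
  exact ⟨_, key.equiv (finSuccEquiv n).symm⟩

/-- Two partitions can be matched once they have equally many members. If `Z` is compact, finite
partitions are brought to a common size by splitting. If not, no nonempty open set is compact, since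
it contains a closed copy of `Z`, and both partitions can be taken countably infinite. -/
theorem exists_matched_small [SecondCountableTopology Z]
    (hcopy : ∀ W : Set Z, IsOpen W → W.Nonempty →
      ∃ e : Z → Z, IsClosedEmbedding e ∧ range e ⊆ W ∧ interior (range e) = ∅)
    (hG : ∀ S T, G T → S ⊆ T → G S) (hP : IsClopen P) (hPn : P.Nonempty) (hQ : IsClopen Q)
    (hQn : Q.Nonempty) (hlocP : ∀ x ∈ P, ∃ O ∈ 𝓝 x, G O) (hlocQ : ∀ x ∈ Q, ∃ O ∈ 𝓝 x, G O) :
    ∃ α β, Matched G P Q α β := by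
  by_cases hc : CompactSpace Z
  · have hZ : ∀ x : Z, ¬ IsOpen {x} := by
      intro x hx
      obtain ⟨e, -, h2, h3⟩ := hcopy _ hx (singleton_nonempty x)
      have : range e = {x} := by
        refine Subset.antisymm h2 (singleton_subset_iff.2 ⟨x, h2 (mem_range_self x)⟩)
      rw [this, hx.interior_eq] at h3
      exact singleton_ne_empty x h3
    obtain ⟨n, a, ha⟩ := exists_finite_clopenPartition hP.isOpen hPn hP.isClosed.isCompact hG hlocP
    obtain ⟨m, b, hb⟩ := exists_finite_clopenPartition hQ.isOpen hQn hQ.isClosed.isCompact hG hlocQ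
    have extend : ∀ {R : Set Z}, R.Nonempty → ∀ {k : ℕ} {a : Z → Fin k}, IsClopenPartition G R a →
        ∀ l, k ≤ l → ∃ a' : Z → Fin l, IsClopenPartition G R a' := by
      intro R hR k a ha l hl
      induction l, hl using Nat.le_induction with
      | base => exact ⟨a, ha⟩
      | succ l hl ih =>
        obtain ⟨a', ha'⟩ := ih
        exact ha'.exists_succ hZ hG hR
    obtain ⟨a', ha'⟩ := extend hPn ha _ (le_max_left n m)
    obtain ⟨b', hb'⟩ := extend hQn hb _ (le_max_right n m)
    exact ha'.matched hb'
  · have hnc : ∀ W : Set Z, IsOpen W → W.Nonempty → ¬ IsCompact W := by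
      intro W hW hWn hWc
      obtain ⟨e, h1, h2, -⟩ := hcopy W hW hWn
      refine hc ⟨h1.isInducing.isCompact_iff.2 ?_⟩
      rw [image_univ]
      exact hWc.of_isClosed_subset h1.isClosed_range h2
    obtain ⟨a, ha⟩ := exists_infinite_clopenPartition hP.isOpen (hnc P hP.isOpen hPn) hG hlocP
    obtain ⟨b, hb⟩ := exists_infinite_clopenPartition hQ.isOpen (hnc Q hQ.isOpen hQn) hG hlocQ
    exact ha.matched hb

/-- The common closed set is the disjoint sum of `A ∩ P` and `A ∩ Q`. In `P` the first summand is
included and the second is copied into `P \ A`; in `Q` the roles are exchanged. Both images then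
absorb all of `A`. -/
theorem exists_matched_disjoint
    (hcopy : ∀ W : Set Z, IsOpen W → W.Nonempty →
      ∃ e : Z → Z, IsClosedEmbedding e ∧ range e ⊆ W ∧ interior (range e) = ∅)
    (hP : IsClopen P) (hPn : P.Nonempty) (hQ : IsClopen Q)
    (hQn : Q.Nonempty) {A : Set Z} (hA : IsClosed A) (hAi : interior A = ∅) :
    ∃ α β, Matched (fun S => Disjoint S A) P Q α β := by
  have key : ∀ {P Q : Set Z}, IsClopen P → P.Nonempty → IsClopen Q →
      ∃ e : Z → Z, IsClosedEmbedding (Sum.elim (fun x : ↥(A ∩ P) => (x : Z)) fun y : ↥(A ∩ Q) => e y) ∧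
        range (Sum.elim (fun x : ↥(A ∩ P) => (x : Z)) fun y : ↥(A ∩ Q) => e y) ⊆ P ∧
        interior (range (Sum.elim (fun x : ↥(A ∩ P) => (x : Z)) fun y : ↥(A ∩ Q) => e y)) = ∅ ∧
        A ∩ P ⊆ range (Sum.elim (fun x : ↥(A ∩ P) => (x : Z)) fun y : ↥(A ∩ Q) => e y) := by
    intro P Q hP hPn hQ
    have hne : (P \ A).Nonempty := by
      rw [nonempty_iff_ne_empty]
      intro h
      have : P ⊆ interior A := interior_maximal (sdiff_eq_empty.1 h) hP.isOpen
      rw [hAi] at this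
      exact hPn.ne_empty (subset_empty_iff.1 this)
    obtain ⟨e, h1, h2, h3⟩ := hcopy _ (hP.isOpen.sdiff hA) hne
    have c1 : IsClosedEmbedding (fun x : ↥(A ∩ P) => (x : Z)) :=
      (hA.inter hP.isClosed).isClosedEmbedding_subtypeVal
    have c2 : IsClosedEmbedding (fun y : ↥(A ∩ Q) => e y) :=
      h1.comp (hA.inter hQ.isClosed).isClosedEmbedding_subtypeVal
    have hr : range (fun y : ↥(A ∩ Q) => e y) ⊆ range e := by
      rintro _ ⟨y, rfl⟩
      exact mem_range_self _
    refine ⟨e, ?_, ?_, ?_, ?_⟩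
    · refine IsClosedEmbedding.of_continuous_injective_isClosedMap
        (c1.continuous.sumElim c2.continuous) ?_ (isClosedMap_sumElim.2 ⟨c1.isClosedMap, c2.isClosedMap⟩)
      refine c1.injective.sumElim c2.injective fun x y hxy => ?_
      exact (h2 (mem_range_self (y : Z))).2 (hxy ▸ x.2.1)
    · rw [Sum.elim_range, union_subset_iff]
      exact ⟨by rw [Subtype.range_coe]; exact inter_subset_right,
        hr.trans (h2.trans sdiff_subset)⟩
    · rw [Sum.elim_range, interior_union_isClosed_of_interior_empty c1.isClosed_range]
      · refine subset_empty_iff.1 ((interior_mono ?_).trans hAi.subset)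
        rw [Subtype.range_coe]
        exact inter_subset_left
      · exact subset_empty_iff.1 ((interior_mono hr).trans h3.subset)
    · rw [Sum.elim_range, Subtype.range_coe]
      exact subset_union_left
  obtain ⟨e, i1, i2, i3, i4⟩ := key hP hPn hQ
  obtain ⟨e', j1, j2, j3, j4⟩ := key hQ hQn hP
  -- The embedding into `Q` is built on the summands in the opposite order; precomposing with the
  -- swap leaves its range unchanged.
  have hs : range ((Sum.elim (fun x : ↥(A ∩ Q) => (x : Z)) fun y : ↥(A ∩ P) => e' y) ∘
      (Homeomorph.sumComm ↥(A ∩ P) ↥(A ∩ Q))) =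
      range (Sum.elim (fun x : ↥(A ∩ Q) => (x : Z)) fun y : ↥(A ∩ P) => e' y) :=
    (Homeomorph.sumComm ↥(A ∩ P) ↥(A ∩ Q)).surjective.range_comp _
  exact exists_matched_of_isClosedEmbedding hP hPn hQ hQn i1
    (j1.comp (Homeomorph.sumComm _ _).isClosedEmbedding) i2 (hs ▸ j2) i3 (hs ▸ j3) i4 (hs ▸ j4)

/-- A Knaster–Reichbach type theorem: if every nonempty open set of `Z` contains a closed nowhere
dense copy of `Z`, then nonempty clopen subsets of `Z` are homeomorphic, provided that decreasing
sequences of small clopen sets are controlled. -/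
theorem nonempty_homeomorph_of_isClopen [SecondCountableTopology Z]
    (hcopy : ∀ W : Set Z, IsOpen W → W.Nonempty →
      ∃ e : Z → Z, IsClosedEmbedding e ∧ range e ⊆ W ∧ interior (range e) = ∅)
    {A : ℕ → Set Z} (hA : ∀ k, IsClosed (A k)) (hAi : ∀ k, interior (A k) = ∅)
    {G : ℕ → Set Z → Prop} (hG : ∀ k S T, G k T → S ⊆ T → G k S)
    (hloc : ∀ k, ∀ x ∉ A k, ∃ O ∈ 𝓝 x, G k O)
    (shrink : ∀ S : ℕ → Set Z, (∀ k, G k (S k)) → ∀ y, (∀ k, y ∈ S k) → ∀ O ∈ 𝓝 y, ∃ k, S k ⊆ O)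
    (complete : ∀ S T : ℕ → Set Z, Antitone S → Antitone T → (∀ k, IsClosed (S k)) →
      (∀ k, IsClosed (T k)) → (∀ k, (S k).Nonempty) → (∀ k, (T k).Nonempty) → (∀ k, G k (S k)) →
      (∀ k, G k (T k)) → (⋂ k, S k).Nonempty → (⋂ k, T k).Nonempty)
    (hP : IsClopen P) (hPn : P.Nonempty) (hQ : IsClopen Q) (hQn : Q.Nonempty) :
    Nonempty (P ≃ₜ Q) := by
  refine nonempty_homeomorph_of_matchings hP hPn hQ hQn (fun k P Q hP hPn hQ hQn => ?_) shrink
    complete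
  -- First `A k` is absorbed into singleton nodes; the remaining clopen nodes miss `A k`, so `hloc`
  -- allows them to be cut into pieces satisfying `G k`.
  obtain ⟨α, β, h⟩ := exists_matched_disjoint hcopy hP hPn hQ hQn (hA k) (hAi k)
  exact h.exists_comp fun P Q hP hPn hPA hQ hQn hQA => exists_matched_small hcopy (hG k) hP hPn hQ hQn
    (fun x hx => hloc k x (disjoint_left.1 hPA hx)) (fun x hx => hloc k x (disjoint_left.1 hQA hx))

end

/-! ### The Baire property of analytic sets -/

section
variable {C : Type*} [TopologicalSpace C] [SecondCountableTopology C]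

/-- Every set has a Baire measurable hull that is minimal up to meagre sets. -/
theorem exists_baireMeasurable_hull (A : Set C) :
    ∃ E, BaireMeasurableSet E ∧ A ⊆ E ∧ E ⊆ closure A ∧
      ∀ B, BaireMeasurableSet B → A ⊆ B → IsMeagre (E \ B) := by
  -- `D` is the closed set of points at which `A` is locally nonmeagre; the hull is `D` together
  -- with the meagre remainder of `A`.
  set D : Set C := {x | ∀ O ∈ 𝓝 x, ¬ IsMeagre (A ∩ O)} with hD
  have hDc : IsClosed D := by
    rw [← isOpen_compl_iff, isOpen_iff_mem_nhds]
    intro x hx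
    obtain ⟨O, hO, hm⟩ : ∃ O ∈ 𝓝 x, IsMeagre (A ∩ O) := by
      by_contra hcon
      push Not at hcon
      exact hx hcon
    obtain ⟨O', h1, h2, h3⟩ := mem_nhds_iff.1 hO
    filter_upwards [h2.mem_nhds h3] with y hy hyD
    exact hyD O' (h2.mem_nhds hy) (hm.mono (inter_subset_inter_right _ h1))
  have hAD : IsMeagre (A \ D) := by
    set S := {O ∈ TopologicalSpace.countableBasis C | IsMeagre (A ∩ O)}
    have hS : S.Countable := (TopologicalSpace.countable_countableBasis C).mono (sep_subset _ _)
    refine (isMeagre_biUnion hS (f := fun O => A ∩ O) fun O hO => hO.2).mono ?_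
    rintro x ⟨hxA, hxD⟩
    obtain ⟨O, hO, hm⟩ : ∃ O ∈ 𝓝 x, IsMeagre (A ∩ O) := by
      by_contra hcon
      push Not at hcon
      exact hxD hcon
    obtain ⟨O', h1, h2, h3⟩ := (TopologicalSpace.isBasis_countableBasis C).mem_nhds_iff.1 hO
    exact mem_biUnion (show O' ∈ S from ⟨h1, hm.mono (inter_subset_inter_right _ h3)⟩) ⟨hxA, h2⟩
  refine ⟨D ∪ (A \ D), hDc.isOpen_compl.baireMeasurableSet.of_compl.union hAD.baireMeasurableSet,
    fun x hx => ?_, union_subset (fun x hx => ?_) (sdiff_subset.trans subset_closure), fun B hB hAB => ?_⟩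
  · by_cases h : x ∈ D
    · exact Or.inl h
    · exact Or.inr ⟨hx, h⟩
  · rw [mem_closure_iff_nhds]
    intro O hO
    rw [inter_comm]
    exact nonempty_of_not_isMeagre (hx O hO)
  -- The difference agrees with an open `u` up to a meagre set. As it misses `A`, the set `A ∩ u` is
  -- meagre, so `u` misses `D`; but the difference lies in `D`, hence it is meagre.
  · set Z := (D ∪ (A \ D)) \ B
    have hZD : Z ⊆ D := by
      rintro x ⟨h | h, hxB⟩
      · exact h
      · exact absurd (hAB h.1) hxB
    have hZ : BaireMeasurableSet Z :=
      (hDc.isOpen_compl.baireMeasurableSet.of_compl.union hAD.baireMeasurableSet).diff hB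
    obtain ⟨u, hu, hZu⟩ := hZ.residualEq_isOpen
    have hZu' : {x | x ∈ Z ↔ x ∈ u} ∈ residual C := by
      filter_upwards [hZu] with x hx
      exact iff_of_eq hx
    have hAu : IsMeagre (A ∩ u) := by
      unfold IsMeagre
      filter_upwards [hZu'] with x hx hxA
      exact (hx.2 hxA.2).2 (hAB hxA.1)
    unfold IsMeagre
    filter_upwards [hZu'] with x hx hxZ
    exact hZD hxZ u (hu.mem_nhds (hx.1 hxZ)) hAu

/-- **Nikodym's theorem**: analytic sets have the Baire property. -/
theorem MeasureTheory.AnalyticSet.baireMeasurableSet [T3Space C] {A : Set C}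
    (hA : MeasureTheory.AnalyticSet A) : BaireMeasurableSet A := by
  rw [MeasureTheory.AnalyticSet] at hA
  rcases hA with rfl | ⟨f, hf, rfl⟩
  · exact IsMeagre.empty.baireMeasurableSet
  set N : List ℕ → Set (ℕ → ℕ) := fun s => {y | PiNat.res y s.length = s} with hN
  choose E hE1 hE2 hE3 hE4 using fun s => exists_baireMeasurable_hull (f '' N s)
  -- The children of `s` cover `f '' N s`, so by minimality their hulls cover the hull of `s` up to
  -- a meagre set. `PiNat.res` lists the latest entry first, so a child is `n :: s`.
  have hM : IsMeagre (⋃ s, E s \ ⋃ n : ℕ, E (n :: s)) := by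
    refine isMeagre_iUnion fun s => hE4 s _ (BaireMeasurableSet.iUnion fun n => hE1 _) ?_
    rintro _ ⟨y, hy, rfl⟩
    refine mem_iUnion.2 ⟨y s.length, hE2 _ ⟨y, ?_, rfl⟩⟩
    change PiNat.res y s.length = s at hy
    change PiNat.res y (s.length + 1) = _
    rw [PiNat.res_succ, hy]
  -- Off the meagre set, a point `x` of the root hull follows an infinite branch `y` through the
  -- hulls. Then `x` lies in the closure of every `f '' N (L k)`, which forces `f y = x` by
  -- continuity and regularity.
  have hsub : E [] \ range f ⊆ ⋃ s, E s \ ⋃ n : ℕ, E (n :: s) := by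
    rintro x ⟨hx, hxf⟩
    by_contra hcon
    have hstep : ∀ s, ∃ n : ℕ, x ∈ E s → x ∈ E (n :: s) := by
      intro s
      by_cases hs : x ∈ E s
      · by_contra h
        push Not at h
        refine hcon (mem_iUnion.2 ⟨s, hs, fun h' => ?_⟩)
        obtain ⟨n, hn⟩ := mem_iUnion.1 h'
        exact (h n).2 hn
      · exact ⟨0, fun h => absurd h hs⟩
    choose n hn using hstep
    let L : ℕ → List ℕ := fun k => Nat.rec [] (fun _ s => n s :: s) k
    have hL : ∀ k, x ∈ E (L k) := by
      intro k
      induction k with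
      | zero => exact hx
      | succ k ih => exact hn _ ih
    have hres : ∀ k, PiNat.res (fun k => n (L k)) k = L k := by
      intro k
      induction k with
      | zero => rfl
      | succ k ih => rw [PiNat.res_succ, ih]
    set y : ℕ → ℕ := fun k => n (L k)
    have hne : f y ≠ x := fun h => hxf ⟨y, h⟩
    obtain ⟨F, hF, hFc, hFx⟩ := exists_mem_nhds_isClosed_subset
      (isOpen_compl_singleton.mem_nhds hne : {x}ᶜ ∈ 𝓝 (f y))
    obtain ⟨_, ⟨y', k, rfl⟩, h1, h2⟩ :=
      (PiNat.isTopologicalBasis_cylinders (E := fun _ : ℕ => ℕ)).mem_nhds_iff.1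
        (hf.continuousAt.preimage_mem_nhds hF)
    rw [← PiNat.mem_cylinder_iff_eq.1 h1] at h2
    have hsub : f '' N (L k) ⊆ F := by
      rintro _ ⟨z, hz, rfl⟩
      apply h2
      have hlen : (L k).length = k := by rw [← hres k, PiNat.res_length]
      change PiNat.res z (L k).length = L k at hz
      rw [hlen, ← hres k, PiNat.res_eq_res] at hz
      exact fun i hi => hz hi
    exact hFx (closure_minimal hsub hFc (hE3 _ (hL k))) rfl
  have : range f = E [] \ (E [] \ range f) := by
    rw [sdiff_sdiff_right_self, eq_comm]
    refine inter_eq_right.2 ?_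
    refine (Eq.subset ?_).trans (hE2 [])
    rw [← image_univ]
    congr 1
    ext y
    simp [hN]
  rw [this]
  exact (hE1 _).diff (hM.mono hsub).baireMeasurableSet

end

/-! ### The category dichotomy -/

section
variable {K : Type*} [TopologicalSpace K]

theorem exists_seq_of_mem_residual {C : Type*} [TopologicalSpace C] [BaireSpace C] {s : Set C}
    (hs : s ∈ residual C) :
    ∃ f : ℕ → Set C, (∀ n, IsOpen (f n)) ∧ (∀ n, Dense (f n)) ∧ ⋂ n, f n ⊆ s := by
  obtain ⟨t, hts, ht, htd⟩ := mem_residual.1 hs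
  obtain ⟨f, hf, rfl⟩ := isGδ_iff_eq_iInter_nat.1 ht
  exact ⟨f, hf, fun n => htd.mono (iInter_subset f n), hts⟩

/-- Continuous preimages of analytic sets are analytic, and the sets with the Baire property form a
σ-algebra. -/
theorem baireMeasurableSet_preimage_of_generateFrom [T2Space K] {X : Set K}
    (hX : @MeasurableSet K (MeasurableSpace.generateFrom
      {A : Set K | MeasureTheory.AnalyticSet A}) X) {C : Type*} [TopologicalSpace C] [PolishSpace C]
    {f : C → K} (hf : Continuous f) : BaireMeasurableSet (f ⁻¹' X) := by
  induction X, hX using MeasurableSpace.generateFrom_induction with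
  | hC t ht _ => exact (MeasureTheory.AnalyticSet.preimage ht hf).baireMeasurableSet
  | empty => exact IsMeagre.empty.baireMeasurableSet
  | compl t _ ih => exact ih.compl
  | iUnion s _ ih =>
    rw [preimage_iUnion]
    exact BaireMeasurableSet.iUnion ih

/-- A set in the σ-algebra generated by the analytic sets is either relatively comeagre in its
closure or meagre in some nonempty relatively open subset of itself. -/
theorem exists_dense_isGδ_or_exists_meagre [PolishSpace K] {X : Set K}
    (hX : @MeasurableSet K (MeasurableSpace.generateFrom
      {A : Set K | MeasureTheory.AnalyticSet A}) X) :
    (∃ g : ℕ → Set K, (∀ n, IsOpen (g n)) ∧ (∀ n, X ⊆ closure (X ∩ g n)) ∧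
      closure X ∩ ⋂ n, g n ⊆ X) ∨
    ∃ (W : Set K) (N : ℕ → Set K), IsOpen W ∧ (X ∩ W).Nonempty ∧ (∀ n, IsClosed (N n)) ∧
      X ∩ W ⊆ ⋃ n, N n ∧ ∀ n O, IsOpen O → X ∩ O ⊆ N n → X ∩ O = ∅ := by
  have : PolishSpace (closure X) := isClosed_closure.polishSpace
  set X' : Set (closure X) := Subtype.val ⁻¹' X with hX'
  obtain ⟨u, hu, hXu⟩ := (baireMeasurableSet_preimage_of_generateFrom hX
    (continuous_subtype_val : Continuous ((↑) : closure X → K))).residualEq_isOpen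
  have hXu' : {x | x ∈ X' ↔ x ∈ u} ∈ residual (closure X) := by
    filter_upwards [hXu] with x hx
    exact iff_of_eq hx
  have hmeet : ∀ O : Set K, IsOpen O → (closure X ∩ O).Nonempty → (X ∩ O).Nonempty := by
    rintro O hO ⟨x, hx, hxO⟩
    rw [inter_comm]
    exact mem_closure_iff.1 hx O hO hxO
  -- Inside its closure, `X` agrees with the open set `u` up to a meagre set. If `u` is dense then
  -- `X` is comeagre there; otherwise `X` is meagre on the nonempty open complement of `closure u`.
  by_cases hd : Dense u
  · left
    have hres : X' ∈ residual (closure X) := by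
      filter_upwards [hXu', residual_of_dense_open hu hd] with x h1 h2
      exact h1.2 h2
    obtain ⟨f, hf, hfd, hfX⟩ := exists_seq_of_mem_residual hres
    choose g hg hgf using fun n => isOpen_induced_iff.1 (hf n)
    refine ⟨g, hg, fun n x hx => ?_, ?_⟩
    · rw [mem_closure_iff]
      intro O hO hxO
      obtain ⟨z, hzO, hz⟩ := (hfd n).inter_open_nonempty _ (hO.preimage continuous_subtype_val)
        ⟨⟨x, subset_closure hx⟩, hxO⟩
      rw [← hgf n] at hz
      obtain ⟨w, hw1, hw2, hw3⟩ := hmeet (O ∩ g n) (hO.inter (hg n)) ⟨z, z.2, hzO, hz⟩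
      exact ⟨w, hw2, hw1, hw3⟩
    · rintro x ⟨hx, hxg⟩
      refine @hfX ⟨x, hx⟩ (mem_iInter.2 fun n => ?_)
      rw [← hgf n]
      exact mem_iInter.1 hxg n
  · right
    obtain ⟨W, hW, hWu⟩ := isOpen_induced_iff.1 (isClosed_closure (s := u)).isOpen_compl
    have hres : (X' ∩ (closure u)ᶜ)ᶜ ∈ residual (closure X) := by
      filter_upwards [hXu'] with x hx hm
      exact hm.2 (subset_closure (hx.1 hm.1))
    obtain ⟨f, hf, hfd, hfX⟩ := exists_seq_of_mem_residual hres
    refine ⟨W, fun n => Subtype.val '' (f n)ᶜ, hW, hmeet W hW ?_, fun n =>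
      isClosed_closure.isClosedEmbedding_subtypeVal.isClosedMap _ (hf n).isClosed_compl, ?_, ?_⟩
    · have : (closure u)ᶜ.Nonempty := by
        rw [nonempty_compl]
        exact fun h => hd (dense_iff_closure_eq.2 h)
      obtain ⟨x, hx⟩ := this
      rw [← hWu] at hx
      exact ⟨x, x.2, hx⟩
    · rintro x ⟨hx, hxW⟩
      have h1 : (⟨x, subset_closure hx⟩ : closure X) ∈ (closure u)ᶜ := by
        rw [← hWu]
        exact hxW
      have h2 : (⟨x, subset_closure hx⟩ : closure X) ∉ ⋂ n, f n := fun h => hfX h ⟨hx, h1⟩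
      rw [mem_iInter] at h2
      push Not at h2
      obtain ⟨n, hn⟩ := h2
      exact mem_iUnion.2 ⟨n, _, hn, rfl⟩
    · intro n O hO hON
      by_contra hne
      obtain ⟨x, hx, hxO⟩ := nonempty_iff_ne_empty.2 hne
      obtain ⟨z, hzO, hz⟩ := (hfd n).inter_open_nonempty _ (hO.preimage continuous_subtype_val)
        ⟨⟨x, subset_closure hx⟩, hxO⟩
      obtain ⟨g, hg, hgf⟩ := isOpen_induced_iff.1 (hf n)
      rw [← hgf] at hz
      obtain ⟨w, hw1, hw2, hw3⟩ := hmeet (O ∩ g) (hO.inter hg) ⟨z, z.2, hzO, hz⟩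
      obtain ⟨w', hw', rfl⟩ := hON ⟨hw1, hw2⟩
      rw [← hgf] at hw'
      exact hw' hw3

end

/-! ### Transfer to subspaces of the Cantor space -/

/-- The Knaster–Reichbach type theorem for subspaces of the Cantor space. -/
theorem nonempty_homeomorph_of_isEmbedding {Z : Type*} [TopologicalSpace Z] {φ : Z → ℕ → Bool}
    (hφ : IsEmbedding φ)
    (hcopy : ∀ W : Set Z, IsOpen W → W.Nonempty →
      ∃ e : Z → Z, IsClosedEmbedding e ∧ range e ⊆ W ∧ interior (range e) = ∅)
    {A : ℕ → Set Z} (hA : ∀ k, IsClosed (A k)) (hAi : ∀ k, interior (A k) = ∅)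
    {G : ℕ → Set Z → Prop} (hG : ∀ k S T, G k T → S ⊆ T → G k S)
    (hloc : ∀ k, ∀ x ∉ A k, ∃ O ∈ 𝓝 x, G k O)
    (complete : ∀ S T : ℕ → Set Z, Antitone S → Antitone T → (∀ k, IsClosed (S k)) →
      (∀ k, IsClosed (T k)) → (∀ k, (S k).Nonempty) → (∀ k, (T k).Nonempty) → (∀ k, G k (S k)) →
      (∀ k, G k (T k)) → (⋂ k, S k).Nonempty → (⋂ k, T k).Nonempty)
    {P Q : Set Z} (hP : IsClopen P) (hPn : P.Nonempty) (hQ : IsClopen Q) (hQn : Q.Nonempty) :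
    Nonempty (P ≃ₜ Q) := by
  let _ : MetricSpace (ℕ → Bool) := PiNat.metricSpace
  let _ : MetricSpace Z := hφ.comapMetricSpace φ
  have : IsUltrametricDist Z :=
    ⟨fun x y z => PiNat.dist_triangle_nonarch (φ x) (φ y) (φ z)⟩
  have : SecondCountableTopology Z := hφ.secondCountableTopology
  refine nonempty_homeomorph_of_isClopen hcopy hA hAi
    -- Requiring the first `k` coordinates to be constant on the set supplies the `shrink`
    -- hypothesis.
    (G := fun k S => (∀ x ∈ S, ∀ y ∈ S, φ y ∈ PiNat.cylinder (φ x) k) ∧ G k S)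
    (fun k S T hT hST => ⟨fun x hx y hy => hT.1 x (hST hx) y (hST hy), hG k S T hT.2 hST⟩)
    (fun k x hx => ?_) (fun S hS y hy O hO => ?_)
    (fun S T h1 h2 h3 h4 h5 h6 h7 h8 => complete S T h1 h2 h3 h4 h5 h6 (fun k => (h7 k).2)
      fun k => (h8 k).2) hP hPn hQ hQn
  · obtain ⟨O, hO, hGO⟩ := hloc k x hx
    refine ⟨O ∩ φ ⁻¹' PiNat.cylinder (φ x) k, inter_mem hO
      (((PiNat.isOpen_cylinder _ (φ x) k).preimage hφ.continuous).mem_nhds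
        (PiNat.self_mem_cylinder _ _)), fun a ha b hb => ?_, hG _ _ _ hGO inter_subset_left⟩
    rw [PiNat.mem_cylinder_iff_eq.1 ha.2]
    exact hb.2
  · rw [hφ.isInducing.nhds_eq_comap, mem_comap] at hO
    obtain ⟨O', hO', hsub⟩ := hO
    obtain ⟨_, ⟨y', k, rfl⟩, h1, h2⟩ :=
      (PiNat.isTopologicalBasis_cylinders (E := fun _ : ℕ => Bool)).mem_nhds_iff.1 hO'
    rw [← PiNat.mem_cylinder_iff_eq.1 h1] at h2
    exact ⟨k, fun x hx => hsub (h2 ((hS k).1 y (hy k) x hx))⟩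

/-! ### Small copies and nowhere dense sets in countable powers -/

section
variable {Y : Type*} [TopologicalSpace Y]

theorem exists_forall_eq_prefix_mem {O : Set (ℕ → Y)} {w : ℕ → Y} (hO : O ∈ 𝓝 w) :
    ∃ n, ∀ z : ℕ → Y, (∀ i < n, z i = w i) → z ∈ O := by
  obtain ⟨O', hsub, ho, hw⟩ := mem_nhds_iff.1 hO
  obtain ⟨I, u, hu, hI⟩ := isOpen_pi_iff.1 ho w hw
  refine ⟨I.sup id + 1, fun z hz => hsub (hI fun i hi => ?_)⟩
  rw [hz i (Nat.lt_succ_of_le (Finset.le_sup (f := id) hi))]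
  exact (hu i hi).2

theorem exists_isClosedEmbedding_range_subset [T2Space Y] [Nontrivial Y] {W : Set (ℕ → Y)}
    (hW : IsOpen W) (hWn : W.Nonempty) :
    ∃ e : (ℕ → Y) → ℕ → Y, IsClosedEmbedding e ∧ range e ⊆ W ∧ interior (range e) = ∅ := by
  obtain ⟨w, hw⟩ := hWn
  obtain ⟨n, hn⟩ := exists_forall_eq_prefix_mem (hW.mem_nhds hw)
  -- The first `2 * n` coordinates of `w` keep the image in `W`. The later even coordinates carry
  -- `z`, and the frozen odd ones make the range nowhere dense.
  refine ⟨fun z i => if Even i ∧ 2 * n ≤ i then z (i / 2 - n) else w i, ?_, ?_, ?_⟩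
  · refine Function.LeftInverse.isClosedEmbedding (f := fun (y : ℕ → Y) k => y (2 * (n + k)))
      (fun z => ?_) (by fun_prop) (continuous_pi fun i => ?_)
    · funext k
      simp
    · split_ifs
      · exact continuous_apply _
      · exact continuous_const
  · rintro _ ⟨z, rfl⟩
    refine hn _ fun i hi => if_neg ?_
    omega
  · rw [eq_empty_iff_forall_notMem]
    intro y hy
    obtain ⟨m, hm⟩ := exists_forall_eq_prefix_mem (mem_interior_iff_mem_nhds.1 hy)
    obtain ⟨c, hc⟩ := exists_ne (w (2 * m + 1))
    obtain ⟨z, hz⟩ := hm (Function.update y (2 * m + 1) c) fun i hi =>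
      Function.update_of_ne (by omega) _ _
    have := congrFun hz (2 * m + 1)
    simp only [Function.update_self] at this
    rw [if_neg (by simp)] at this
    exact hc this.symm

theorem interior_setOf_forall_notMem_eq_empty {W : Set Y} (hW : W.Nonempty) :
    interior {z : ℕ → Y | ∀ i, z i ∉ W} = ∅ := by
  rw [eq_empty_iff_forall_notMem]
  intro y hy
  obtain ⟨m, hm⟩ := exists_forall_eq_prefix_mem (mem_interior_iff_mem_nhds.1 hy)
  obtain ⟨c, hc⟩ := hW
  have := hm (Function.update y m c) fun i hi => Function.update_of_ne hi.ne _ _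
  have := this m
  rw [Function.update_self] at this
  exact this hc

theorem interior_eval_preimage_eq_empty {N : Set Y} (hN : interior N = ∅) (i : ℕ) :
    interior {z : ℕ → Y | z i ∈ N} = ∅ := by
  rw [eq_empty_iff_forall_notMem]
  intro y hy
  have : (fun z : ℕ → Y => z i) '' interior {z : ℕ → Y | z i ∈ N} ⊆ interior N :=
    interior_maximal (image_subset_iff.2 interior_subset) (isOpenMap_eval i _ isOpen_interior)
  rw [hN] at this
  exact this ⟨y, hy, rfl⟩

end

/-! ### The two cases of the dichotomy -/

section
variable {X : Set (ℕ → Bool)}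

/-- The embedding of a countable power of a subspace of the Cantor space into the Cantor space. -/
def powerEmbedding (X : Set (ℕ → Bool)) (z : ℕ → X) (n : ℕ) : Bool :=
  (z n.unpair.1 : ℕ → Bool) n.unpair.2

theorem isEmbedding_coe_pi (X : Set (ℕ → Bool)) :
    IsEmbedding fun (z : ℕ → X) (i : ℕ) => (z i : ℕ → Bool) :=
  IsEmbedding.piMap (f := fun _ : ℕ => (Subtype.val : X → ℕ → Bool)) fun _ => IsEmbedding.subtypeVal

theorem isEmbedding_powerEmbedding (X : Set (ℕ → Bool)) : IsEmbedding (powerEmbedding X) := by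
  refine IsEmbedding.of_comp (g := fun (w : ℕ → Bool) (i j : ℕ) => w (Nat.pair i j)) ?_ ?_ ?_
  · exact continuous_pi fun n => (continuous_apply n.unpair.2).comp
      (continuous_subtype_val.comp (continuous_apply n.unpair.1))
  · fun_prop
  · convert isEmbedding_coe_pi X using 1
    funext z i j
    simp [powerEmbedding]

theorem isHHomogeneous_of_clopen_homeomorph {Y : Type*} [TopologicalSpace Y]
    (h : ∀ P Q : Set Y, IsClopen P → P.Nonempty → IsClopen Q → Q.Nonempty → Nonempty (P ≃ₜ Q)) :
    IsHHomogeneous Y := by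
  intro C hC hCn
  obtain ⟨e⟩ := h C univ hC hCn isClopen_univ (hCn.mono (subset_univ _))
  exact ⟨e.trans (Homeomorph.Set.univ Y)⟩

/-- The sets `A k` cover the power: a point with no coordinate in `W` lies in all of them, and any
other point has a coordinate in some `N n`. Hence sets disjoint from the successive `A k` have no
common point, and the completeness hypothesis holds vacuously. -/
theorem isHHomogeneous_pi_of_meagre [Nontrivial X] {W : Set (ℕ → Bool)} {N : ℕ → Set (ℕ → Bool)}
    (hW : IsOpen W) (hXW : (X ∩ W).Nonempty) (hN : ∀ n, IsClosed (N n)) (hsub : X ∩ W ⊆ ⋃ n, N n)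
    (hnd : ∀ n O, IsOpen O → X ∩ O ⊆ N n → X ∩ O = ∅) : IsHHomogeneous (ℕ → X) := by
  set A : ℕ → Set (ℕ → X) := fun k => {z | ∀ i, z i ∉ (Subtype.val ⁻¹' W : Set X)} ∪
    {z | z k.unpair.1 ∈ (Subtype.val ⁻¹' N k.unpair.2 : Set X)} with hAdef
  have hclosed : IsClosed {z : ℕ → X | ∀ i, z i ∉ (Subtype.val ⁻¹' W : Set X)} := by
    simp only [ofPred_forall]
    refine isClosed_iInter fun i => ?_
    exact (hW.preimage (continuous_subtype_val.comp (continuous_apply i))).isClosed_compl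
  have hA : ∀ k, IsClosed (A k) := fun k =>
    hclosed.union ((hN _).preimage (continuous_subtype_val.comp (continuous_apply _)))
  have hAi : ∀ k, interior (A k) = ∅ := by
    intro k
    rw [hAdef, interior_union_isClosed_of_interior_empty hclosed]
    · refine interior_setOf_forall_notMem_eq_empty ?_
      obtain ⟨x, hx, hxW⟩ := hXW
      exact ⟨⟨x, hx⟩, hxW⟩
    · refine interior_eval_preimage_eq_empty ?_ _
      obtain ⟨O, hO, hOi⟩ := isOpen_induced_iff.1
        (isOpen_interior (s := (Subtype.val ⁻¹' N k.unpair.2 : Set X)))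
      have := hnd _ O hO (fun x ⟨hx, hxO⟩ => by
        have : (⟨x, hx⟩ : X) ∈ interior (Subtype.val ⁻¹' N k.unpair.2 : Set X) := by
          rw [← hOi]; exact hxO
        exact (interior_subset this : (⟨x, hx⟩ : X) ∈ (Subtype.val ⁻¹' N k.unpair.2 : Set X)))
      rw [← hOi, eq_empty_iff_forall_notMem]
      intro x hx
      exact (this ▸ (⟨x.2, hx⟩ : (x : ℕ → Bool) ∈ X ∩ O) : (x : ℕ → Bool) ∈ (∅ : Set (ℕ → Bool)))
  refine isHHomogeneous_of_clopen_homeomorph fun P Q hP hPn hQ hQn =>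
    nonempty_homeomorph_of_isEmbedding (isEmbedding_powerEmbedding X)
      (fun W hW hWn => exists_isClosedEmbedding_range_subset hW hWn) hA hAi
      (G := fun k S => Disjoint S (A k)) (fun k S T hT hST => hT.mono_left hST)
      (fun k x hx => ⟨(A k)ᶜ, (hA k).isOpen_compl.mem_nhds hx, disjoint_compl_left⟩)
      (fun S T _ _ _ _ _ _ hS _ ⟨x, hx⟩ => ?_) hP hPn hQ hQn
  exfalso
  rw [mem_iInter] at hx
  by_cases hxW : ∀ i, x i ∉ (Subtype.val ⁻¹' W : Set X)
  · exact disjoint_left.1 (hS 0) (hx 0) (Or.inl hxW)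
  · push Not at hxW
    obtain ⟨i, hi⟩ := hxW
    obtain ⟨n, hn⟩ := mem_iUnion.1 (hsub ⟨(x i).2, hi⟩)
    refine disjoint_left.1 (hS (Nat.pair i n)) (hx _) (Or.inr ?_)
    change (x (Nat.pair i n).unpair.1 : ℕ → Bool) ∈ N (Nat.pair i n).unpair.2
    rw [Nat.unpair_pair]
    exact hn

/-- Here every sequence of admissible sets has a common point. Requiring the closure in the compact
product to lie in `O k`, rather than just the set itself, forces the limit into every `O k`, hence
into the power of `X`. -/
theorem isHHomogeneous_pi_of_comeagre [Nontrivial X] {g : ℕ → Set (ℕ → Bool)}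
    (hg : ∀ n, IsOpen (g n)) (hd : ∀ n, X ⊆ closure (X ∩ g n)) (hsub : closure X ∩ ⋂ n, g n ⊆ X) :
    IsHHomogeneous (ℕ → X) := by
  set ι : (ℕ → X) → ℕ → ℕ → Bool := fun z i => (z i : ℕ → Bool) with hι
  set O : ℕ → Set (ℕ → ℕ → Bool) := fun k => {w | w k.unpair.1 ∈ g k.unpair.2} with hOdef
  have hO : ∀ k, IsOpen (O k) := fun k => (hg _).preimage (continuous_apply _)
  have hιe : IsEmbedding ι := isEmbedding_coe_pi X
  have hAi : ∀ k, interior (ι ⁻¹' (O k)ᶜ) = ∅ := by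
    intro k
    refine interior_eval_preimage_eq_empty (N := (Subtype.val ⁻¹' g k.unpair.2 : Set X)ᶜ) ?_ _
    rw [interior_compl, compl_empty_iff, eq_univ_iff_forall]
    intro x
    rw [closure_subtype, Subtype.image_preimage_coe]
    exact hd _ x.2
  refine isHHomogeneous_of_clopen_homeomorph fun P Q hP hPn hQ hQn =>
    nonempty_homeomorph_of_isEmbedding (isEmbedding_powerEmbedding X)
      (fun W hW hWn => exists_isClosedEmbedding_range_subset hW hWn)
      (A := fun k => ι ⁻¹' (O k)ᶜ) (fun k => (hO k).isClosed_compl.preimage hιe.continuous) hAi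
      (G := fun k S => closure (ι '' S) ⊆ O k)
      (fun k S T hT hST => (closure_mono (image_mono hST)).trans hT)
      (fun k x hx => ?_) (fun S T _ hTa _ hTc _ hTn _ hTG _ => ?_) hP hPn hQ hQn
  · have hx' : ι x ∈ O k := by simpa using hx
    obtain ⟨F, hF, hFc, hFO⟩ := exists_mem_nhds_isClosed_subset ((hO k).mem_nhds hx')
    exact ⟨ι ⁻¹' F, hιe.continuous.continuousAt.preimage_mem_nhds hF,
      (closure_minimal (image_preimage_subset _ _) hFc).trans hFO⟩
  · obtain ⟨w, hw⟩ := IsCompact.nonempty_iInter_of_sequence_nonempty_isCompact_isClosed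
      (fun k => closure (ι '' T k)) (fun k => closure_mono (image_mono (hTa (Nat.le_succ k))))
      (fun k => ((hTn k).image ι).closure) isClosed_closure.isCompact (fun k => isClosed_closure)
    rw [mem_iInter] at hw
    have hwX : ∀ i, w i ∈ X := by
      intro i
      refine hsub ⟨?_, mem_iInter.2 fun n => ?_⟩
      · have hc : IsClosed {w : ℕ → ℕ → Bool | w i ∈ closure X} :=
          isClosed_closure.preimage (continuous_apply i)
        refine closure_minimal ?_ hc (hw 0)
        rintro _ ⟨z, -, rfl⟩
        exact subset_closure (z i).2
      · have := hTG _ (hw (Nat.pair i n))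
        simpa [hOdef] using this
    refine ⟨fun i => ⟨w i, hwX i⟩, mem_iInter.2 fun k => ?_⟩
    -- As `T k` is closed in the power of `X`, it contains each point of that power lying in the
    -- closure of its image.
    rw [← (hTc k).closure_eq, hιe.isInducing.closure_eq_preimage_closure_image]
    exact hw k

end

theorem mainTheorem3 (X : Set (ℕ → Bool))
    (hX : @MeasurableSet (ℕ → Bool) (MeasurableSpace.generateFrom
      {A : Set (ℕ → Bool) | MeasureTheory.AnalyticSet A}) X) :
    IsHHomogeneous (ℕ → X) := by
  -- Nowhere dense copies of the power require two points in `X`; with at most one, a nonempty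
  -- clopen set is the whole space.
  rcases subsingleton_or_nontrivial X with hs | hn
  · intro C _ hC
    obtain rfl : C = univ := Subsingleton.eq_univ_of_nonempty hC
    exact ⟨Homeomorph.Set.univ _⟩
  · have : TopologicalSpace.IsCompletelyMetrizableSpace (ℕ → Bool) :=
      ⟨PiNat.metricSpace, rfl, PiNat.completeSpace⟩
    rcases exists_dense_isGδ_or_exists_meagre hX with
      ⟨g, h1, h2, h3⟩ | ⟨W, N, h1, h2, h3, h4, h5⟩
    · exact isHHomogeneous_pi_of_comeagre h1 h2 h3
    · exact isHHomogeneous_pi_of_meagre h1 h2 h3 h4 h5
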